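/- For $k>0$ let $\chi_k$ denote the chi distribution with $k$ degrees of freedom, i.e. the probability distribution on $(0,\infty)$ with density $\frac{2^{1-k/2}}{\Gamma(k/2)}x^{k-1}e^{-x^2/2}$, and let $\tilde\chi_k$ denote the distribution of $\chi_k/\sqrt2$. For $N\ge 1$, $\beta>0$, $\alpha>-1$, put $\kappa=\beta/2$ and let $\tilde J_N=\tilde B_N\tilde B_N^{t}$, where $\tilde B_N$ is the random $N\times N$ lower bidiagonal matrix with independent non-trivial entries distributed as $$\tilde B_N=\begin{pmatrix}\tilde\chi_{2\alpha+2+2\kappa(N-1)}\\ \tilde\chi_{2\kappa(N-1)}&\tilde\chi_{2\alpha+2+2\kappa(N-2)}\\ &\ddots&\ddots\\ &&\tilde\chi_{2\kappa}&\tilde\chi_{2\alpha+2}\end{pmatrix}.$$ For $\alpha>-1$ and $c\ge 0$ let $J_{\alpha,c}=W_{\alpha,c}W_{\alpha,c}^{t}$ be the infinite Jacobi matrix with $$W_{\alpha,c}=\begin{pmatrix}\sqrt{\alpha+c+1}\\ \sqrt{c+1}&\sqrt{\alpha+c+2}\\ &\sqrt{c+2}&\sqrt{\alpha+c+3}\\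 &&\ddots&\ddots\end{pmatrix},$$ and let $\mu_{\alpha,c}$ be its spectral measure, i.e. the unique probability measure on $\mathbb R$ with finite moments of all orders satisfying $\int x^k\,d\mu_{\alpha,c}(x)=(J_{\alpha,c})^k(1,1)$ for all $k=0,1,2,\dots$. **Theorem.** Let $\alpha>-1$ and $c\ge 0$ be given. Then $\mu_{\alpha,c}$ is well defined (it exists and is unique). Moreover, let $\beta=\beta_N>0$ $(N\ge1)$ satisfy $\beta_N N\to 2c$ as $N\to\infty$, and let $\tilde J_N$ have parameters $(N,\beta_N,\alpha)$. Then for every $r\in\{0,1,2,\dots\}$ and every $N\ge1$ the following expectations are finite and satisfy $$\mathbb E\Big[\tfrac1N\operatorname{tr}\big((\tilde J_N)^r\big)\Big]=\mathbb E\big[(\tilde J_N)^r(1,1)\big],$$ and as $N\to\infty$ both sides converge to $\int x^r\,d\mu_{\alpha,c}(x)$. -/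

import Mathlib

open MeasureTheory ProbabilityTheory Filter Topology

namespace BetaLaguerre

noncomputable section

/-- The chi distribution with `k > 0` (not necessarily integral) degrees of freedom: the measure on
`(0, ∞)` with density `2 ^ (1 - k / 2) / Γ(k / 2) * x ^ (k - 1) * exp (-x ^ 2 / 2)`. -/
def chiMeasure (k : ℝ) : Measure ℝ :=
  (volume.restrict (Set.Ioi 0)).withDensity fun x =>
    ENNReal.ofReal
      (2 ^ (1 - k / 2) / Real.Gamma (k / 2) * x ^ (k - 1) * Real.exp (-x ^ 2 / 2))

/-- The law of `χ_k / √2`, where `χ_k` has the chi distribution with `k` degrees of freedom. -/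
def scaledChiMeasure (k : ℝ) : Measure ℝ :=
  (chiMeasure k).map fun x => x / √2

/-- The lower bidiagonal `N × N` matrix with diagonal `x` and subdiagonal `y`. -/
def bidiagonal {N : ℕ} (x : Fin N → ℝ) (y : Fin (N - 1) → ℝ) : Matrix (Fin N) (Fin N) ℝ :=
  Matrix.of fun i j =>
    if i = j then x i
    else if h : (i : ℕ) = j + 1 then y ⟨j, by omega⟩
    else 0

/-- The Jacobi matrix `B Bᵗ`, where `B` is lower bidiagonal with diagonal `x` and subdiagonal
`y`. -/
def jacobi {N : ℕ} (x : Fin N → ℝ) (y : Fin (N - 1) → ℝ) : Matrix (Fin N) (Fin N) ℝ :=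
  bidiagonal x y * (bidiagonal x y).transpose

/-- The `(1,1)` entry (upper left corner) of a square matrix of size `N ≥ 1`; the value for `N = 0`
is irrelevant. -/
def topLeft {N : ℕ} (A : Matrix (Fin N) (Fin N) ℝ) : ℝ :=
  if h : 0 < N then A ⟨0, h⟩ ⟨0, h⟩ else 0

/-- The random variables `x 0, …, x (N - 1)` and `y 0, …, y (N - 2)` are (jointly) independent, and
they are distributed as the diagonal and the subdiagonal of the bidiagonal matrix of the scaled
beta Laguerre ensemble with parameters `(N, κ, α)`, that is, from top to bottom, as scaled chi
variables with
`2α + 2 + 2κ(N - 1), 2α + 2 + 2κ(N - 2), …, 2α + 2` and `2κ(N - 1), 2κ(N - 2), …, 2κ`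
degrees of freedom. -/
structure IsLaguerreModel {Ω : Type*} [MeasurableSpace Ω] (P : Measure Ω) {N : ℕ} (κ α : ℝ)
    (x : Fin N → Ω → ℝ) (y : Fin (N - 1) → Ω → ℝ) : Prop where
  law_diag : ∀ i : Fin N,
    HasLaw (x i) (scaledChiMeasure (2 * α + 2 + 2 * κ * ((N : ℝ) - 1 - (i : ℕ)))) P
  law_sub : ∀ j : Fin (N - 1),
    HasLaw (y j) (scaledChiMeasure (2 * κ * ((N : ℝ) - 1 - (j : ℕ)))) P
  indep : iIndepFun (Sum.elim x y) P

/-- The product of two infinite matrices. It is used only for banded matrices, for which each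
sum has finitely many non-zero terms. -/
def infMul (A B : Matrix ℕ ℕ ℝ) : Matrix ℕ ℕ ℝ :=
  Matrix.of fun i j => ∑ᶠ k, A i k * B k j

/-- The powers of an infinite (banded) matrix. -/
def infPow (A : Matrix ℕ ℕ ℝ) : ℕ → Matrix ℕ ℕ ℝ
  | 0 => 1
  | r + 1 => infMul (infPow A r) A

/-- The infinite lower bidiagonal matrix `W_{α,c}` with diagonal
`√(α + c + 1), √(α + c + 2), …` and subdiagonal `√(c + 1), √(c + 2), …`. -/
def assocLaguerreW (α c : ℝ) : Matrix ℕ ℕ ℝ :=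
  Matrix.of fun i j =>
    if i = j then √(α + c + (i + 1)) else if i = j + 1 then √(c + (j + 1)) else 0

/-- The Jacobi matrix `J_{α,c} = W_{α,c} W_{α,c}ᵗ` of the associated Laguerre polynomials. -/
def assocLaguerreJ (α c : ℝ) : Matrix ℕ ℕ ℝ :=
  infMul (assocLaguerreW α c) (assocLaguerreW α c).transpose

/-- `μ` is a probability measure on `ℝ` whose `k`-th moment exists and equals `J ^ k (1,1)`, for
all `k = 0, 1, 2, …`. -/
structure SolvesMomentProblem (J : Matrix ℕ ℕ ℝ) (μ : Measure ℝ) : Prop where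
  isProbabilityMeasure : IsProbabilityMeasure μ
  integrable_pow : ∀ k : ℕ, Integrable (fun x : ℝ => x ^ k) μ
  moment_eq : ∀ k : ℕ, ∫ x, x ^ k ∂μ = infPow J k 0 0

/-- `μ` is the spectral measure of the infinite Jacobi matrix `J`: the moment problem
`∫ x ^ k dμ = J ^ k (1,1)` has a unique solution among probability measures, namely `μ`. -/
structure IsSpectralMeasure (J : Matrix ℕ ℕ ℝ) (μ : Measure ℝ) : Prop where
  solves : SolvesMomentProblem J μ
  unique : ∀ ν : Measure ℝ, SolvesMomentProblem J ν → ν = μ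

end

end BetaLaguerre

namespace BetaLaguerre

open MvPolynomial Finset Matrix

noncomputable section

/-! ### Derivations acting entrywise on matrices -/

section Derivation

variable {R ι : Type*} [CommRing R] [Algebra ℝ R]

/-! Write `N = n + 1`, `F_k = (J ^ k)(1,1)`, `T_k = tr (J ^ k)`, and let `Q` be a product of traces.
The expectation is a linear functional `E` on polynomials in the bidiagonal entries. An entry with
`d` degrees of freedom has density proportional to `x ^ (d - 1) * exp (-x ^ 2)`, and the loop
equation uses the law only through the resulting integration by parts formula `IntByParts`.

The key is invariance under the Toda flows, whose Lax form is `J' = [J, skewPart (J ^ k)]`. They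
conserve every `T_l`, in particular `T_1`, the exponent of the Gaussian weight, and they preserve
logarithmic volume. Only the power weight varies, at the rate `2κ (T_k - N F_k)`
(`sum_dof_mul_todaA`). Hence `E (V_k h) = 2κ (N E (F_k h) - E (T_k h))` (`expect_todaV`). For `h =
Q` the left side vanishes, so `N E (F_k Q) = E (T_k Q)`; the case `Q = 1` is the trace identity. For
`h = F_l Q` the Riccati equation for `F_l` eliminates products `F_k F_l`. Integration by parts in
the upper left entry, combined with the Euler field, then closes up into `expect_recurrence`. When
`κ N → c`, the normalized expectations factorize in the limit, with factors obeying `m (r + 1) = (α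
+ 1 + r + c) m r + c ∑_{l < r} m l * m (r - l)` (`tendsto_expect`).

The moments of `J_{α,c}` obey the same recurrence, because of a double commutator relation between
the number operator and `J_{α,c}` (`momentRec_assocMoment`). A solution of the moment problem is a
weak limit of spectral measures of finite truncations. It is unique because the recurrence forces
`|m r| ≤ K ^ r * r!`, so the moments determine the characteristic function by analytic continuation.
-/

theorem map_derivation_mul [Fintype ι] (D : Derivation ℝ R R) (A B : Matrix ι ι R) :
    (A * B).map D = A.map D * B + A * B.map D := by
  ext i j
  simp only [Matrix.map_apply, Matrix.mul_apply, map_sum, Matrix.add_apply, Derivation.leibniz,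
    smul_eq_mul, ← Finset.sum_add_distrib]
  exact Finset.sum_congr rfl fun k _ => by ring

theorem map_derivation_one [DecidableEq ι] (D : Derivation ℝ R R) : (1 : Matrix ι ι R).map D = 0 := by
  ext i j
  simp only [Matrix.map_apply, Matrix.one_apply]
  split_ifs <;> simp

variable [Fintype ι] [DecidableEq ι]

theorem map_derivation_pow_succ (D : Derivation ℝ R R) (A : Matrix ι ι R) (r : ℕ) :
    (A ^ (r + 1)).map D = ∑ p ∈ antidiagonal r, A ^ p.1 * A.map D * A ^ p.2 := by
  induction r with
  | zero => simp
  | succ r ih =>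
    rw [pow_succ' A (r + 1), map_derivation_mul, ih, Finset.Nat.antidiagonal_succ,
      Finset.sum_cons, Finset.mul_sum, Finset.sum_map]
    simp [pow_succ', mul_assoc]

theorem map_derivation_pow_of_commutator (D : Derivation ℝ R R) {A K : Matrix ι ι R}
    (h : A.map D = A * K - K * A) (r : ℕ) : (A ^ r).map D = A ^ r * K - K * A ^ r := by
  induction r with
  | zero => simp [map_derivation_one]
  | succ r ih =>
    rw [pow_succ, map_derivation_mul, ih, h]
    noncomm_ring

theorem map_derivation_pow_of_smul (D : Derivation ℝ R R) {A : Matrix ι ι R} (c : ℝ)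
    (h : A.map D = c • A) (r : ℕ) : (A ^ r).map D = (r * c : ℝ) • A ^ r := by
  induction r with
  | zero => simp [map_derivation_one]
  | succ r ih =>
    rw [pow_succ, map_derivation_mul, ih, h]
    simp only [Matrix.smul_mul, Matrix.mul_smul, ← add_smul]
    congr 1
    push_cast
    ring

end Derivation

/-! ### The bidiagonal matrix with indeterminate entries and its logarithmic derivatives -/

/-- The non-trivial positions of a lower bidiagonal matrix of size `n + 1`. -/
abbrev Idx (n : ℕ) := Fin (n + 1) ⊕ Fin n

variable {n : ℕ}

def Idx.row : Idx n → Fin (n + 1) := Sum.elim id Fin.succ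

def Idx.col : Idx n → Fin (n + 1) := Sum.elim id Fin.castSucc

/-- The bidiagonal matrix with indeterminate entries. -/
def polyB (n : ℕ) : Matrix (Fin (n + 1)) (Fin (n + 1)) (MvPolynomial (Idx n) ℝ) :=
  Matrix.of fun i j =>
    if i = j then X (Sum.inl i)
    else if h : (i : ℕ) = j + 1 then X (Sum.inr ⟨j, by omega⟩)
    else 0

def polyJ (n : ℕ) := polyB n * (polyB n).transpose

def polyJt (n : ℕ) := (polyB n).transpose * polyB n

/-- The upper left entry of the `k`-th power of the Jacobi matrix. -/
def polyF (n k : ℕ) : MvPolynomial (Idx n) ℝ := (polyJ n ^ k) 0 0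

/-- The trace of the `k`-th power of the Jacobi matrix. -/
def polyTr (n k : ℕ) : MvPolynomial (Idx n) ℝ := (polyJ n ^ k).trace

/-- The logarithmic derivative `X_z ∂ / ∂ X_z`. -/
def logD (z : Idx n) : Derivation ℝ (MvPolynomial (Idx n) ℝ) (MvPolynomial (Idx n) ℝ) :=
  (X z : MvPolynomial (Idx n) ℝ) • pderiv z

theorem logD_X (z w : Idx n) : logD z (X w) = if w = z then X z else 0 := by
  classical
  simp only [logD, Derivation.smul_apply, pderiv_X, Pi.single_apply, smul_eq_mul]
  split_ifs <;> simp_all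

theorem polyB_row_col (z : Idx n) : polyB n z.row z.col = X z := by
  rcases z with i | j
  · simp [polyB, Idx.row, Idx.col]
  · have : j.succ ≠ j.castSucc := by simp [Fin.ext_iff]
    simp [polyB, Idx.row, Idx.col, this]

theorem polyB_eq_zero {i j : Fin (n + 1)} (h : i ≠ j) (h' : (i : ℕ) ≠ j + 1) :
    polyB n i j = 0 := by
  simp [polyB, h, h']

theorem exists_idx {i j : Fin (n + 1)} (h : i = j ∨ (i : ℕ) = j + 1) :
    ∃ z : Idx n, z.row = i ∧ z.col = j := by
  rcases h with rfl | h
  · exact ⟨Sum.inl i, rfl, rfl⟩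
  · refine ⟨Sum.inr ⟨j, by omega⟩, ?_, ?_⟩ <;> ext <;> simp [Idx.row, Idx.col, h]

theorem idx_ext {z w : Idx n} (h : z.row = w.row) (h' : z.col = w.col) : z = w := by
  rcases z with i | j <;> rcases w with k | l <;> simp [Idx.row, Idx.col, Fin.ext_iff] at * <;>
    omega

theorem row_or (z : Idx n) : z.row = z.col ∨ (z.row : ℕ) = z.col + 1 := by
  rcases z with i | j <;> simp [Idx.row, Idx.col]

theorem map_logD_polyB (z : Idx n) :
    (polyB n).map (logD z) = Matrix.single z.row z.col (X z) := by
  ext1 i j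
  rw [Matrix.map_apply, Matrix.single_apply]
  by_cases h : i = j ∨ (i : ℕ) = j + 1
  · obtain ⟨w, rfl, rfl⟩ := exists_idx h
    rw [polyB_row_col, logD_X]
    by_cases hw : w = z
    · simp [hw]
    · rw [if_neg hw, if_neg]
      rintro ⟨h1, h2⟩
      exact hw (idx_ext h1.symm h2.symm)
  · push Not at h
    rw [polyB_eq_zero h.1 h.2, map_zero, if_neg]
    rintro ⟨rfl, rfl⟩
    rcases row_or z with h1 | h1
    exacts [h.1 h1, h.2 h1]

theorem polyJ_pow_mul_polyB (k : ℕ) : polyJ n ^ k * polyB n = polyB n * polyJt n ^ k := by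
  induction k with
  | zero => simp
  | succ k ih =>
    rw [pow_succ', mul_assoc, ih, pow_succ']
    simp only [polyJ, polyJt, mul_assoc]

theorem polyJ_transpose : (polyJ n).transpose = polyJ n := by
  simp [polyJ, Matrix.transpose_mul]

theorem polyJt_transpose : (polyJt n).transpose = polyJt n := by
  simp [polyJt, Matrix.transpose_mul]

theorem map_logD_polyB_transpose (z : Idx n) :
    (polyB n).transpose.map (logD z) = Matrix.single z.col z.row (X z) := by
  rw [Matrix.transpose_map, map_logD_polyB, Matrix.transpose_single]

/-- The common value `J ^ b B = B (Bᵗ B) ^ b`. -/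
def polyG (n b : ℕ) := polyJ n ^ b * polyB n

theorem single_mul_mul (A C : Matrix (Fin (n + 1)) (Fin (n + 1)) (MvPolynomial (Idx n) ℝ))
    (p q i j : Fin (n + 1)) (x : MvPolynomial (Idx n) ℝ) :
    (A * Matrix.single p q x * C) i j = x * (A i p * C q j) := by
  rw [Matrix.mul_assoc, Matrix.mul_apply, Finset.sum_eq_single p]
  · rw [Matrix.single_mul_apply_same]; ring
  · intro b _ hb
    rw [Matrix.single_mul_apply_of_ne (h := hb), mul_zero]
  · simp

theorem polyJ_pow_symm (k : ℕ) (i j : Fin (n + 1)) : (polyJ n ^ k) i j = (polyJ n ^ k) j i := by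
  conv_lhs => rw [← polyJ_transpose, ← Matrix.transpose_pow, Matrix.transpose_apply]

theorem polyJt_pow_symm (k : ℕ) (i j : Fin (n + 1)) :
    (polyJt n ^ k) i j = (polyJt n ^ k) j i := by
  conv_lhs => rw [← polyJt_transpose, ← Matrix.transpose_pow, Matrix.transpose_apply]

theorem transpose_mul_pow_apply (b : ℕ) (p q : Fin (n + 1)) :
    ((polyB n).transpose * polyJ n ^ b) q p = polyG n b p q := by
  rw [polyG, ← Matrix.transpose_apply (polyJ n ^ b * polyB n), Matrix.transpose_mul,
    Matrix.transpose_pow, polyJ_transpose]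

theorem pow_mul_transpose_apply (b : ℕ) (p q : Fin (n + 1)) :
    (polyJt n ^ b * (polyB n).transpose) q p = polyG n b p q := by
  rw [polyG, polyJ_pow_mul_polyB, ← Matrix.transpose_apply (polyB n * polyJt n ^ b),
    Matrix.transpose_mul, Matrix.transpose_pow, polyJt_transpose]

theorem map_logD_polyJ (z : Idx n) :
    (polyJ n).map (logD z) = Matrix.single z.row z.col (X z) * (polyB n).transpose
      + polyB n * Matrix.single z.col z.row (X z) := by
  rw [polyJ, map_derivation_mul, map_logD_polyB, map_logD_polyB_transpose]

theorem map_logD_polyJt (z : Idx n) :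
    (polyJt n).map (logD z) = Matrix.single z.col z.row (X z) * polyB n
      + (polyB n).transpose * Matrix.single z.row z.col (X z) := by
  rw [polyJt, map_derivation_mul, map_logD_polyB, map_logD_polyB_transpose]

/-- `X z` occurs in a single entry of `B`, so each term of the product rule for `J ^ (k + 1)` splits
into two rank-one contributions, one from `B` and one from its transpose. By symmetry of `J` they
are exchanged when the two exponents are swapped, whence the factor 2. -/
theorem logD_polyJ_pow_apply (z : Idx n) (k : ℕ) (i : Fin (n + 1)) :
    logD z ((polyJ n ^ (k + 1)) i i) = 2 * ∑ p ∈ antidiagonal k,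
      X z * ((polyJ n ^ p.1) i z.row * polyG n p.2 i z.col) := by
  rw [← Matrix.map_apply (f := logD z) (M := polyJ n ^ (k + 1)), map_derivation_pow_succ,
    Matrix.sum_apply, two_mul]
  have h1 : ∀ p : ℕ × ℕ, (polyJ n ^ p.1 * (polyJ n).map (logD z) * polyJ n ^ p.2) i i =
      X z * ((polyJ n ^ p.1) i z.row * polyG n p.2 i z.col) +
      X z * ((polyJ n ^ p.2) i z.row * polyG n p.1 i z.col) := by
    intro p
    rw [map_logD_polyJ, mul_add, add_mul, Matrix.add_apply]
    congr 1
    · rw [← mul_assoc, mul_assoc, single_mul_mul, transpose_mul_pow_apply]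
    · rw [← mul_assoc, single_mul_mul, polyG, polyJ_pow_symm p.2 i]
      ring
  simp only [h1, Finset.sum_add_distrib]
  congr 1
  rw [← Finset.Nat.sum_antidiagonal_swap]
  rfl

theorem logD_polyJt_pow_apply (z : Idx n) (k : ℕ) (i : Fin (n + 1)) :
    logD z ((polyJt n ^ (k + 1)) i i) = 2 * ∑ p ∈ antidiagonal k,
      X z * ((polyJt n ^ p.1) i z.col * polyG n p.2 z.row i) := by
  rw [← Matrix.map_apply (f := logD z) (M := polyJt n ^ (k + 1)), map_derivation_pow_succ,
    Matrix.sum_apply, two_mul]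
  have h1 : ∀ p : ℕ × ℕ, (polyJt n ^ p.1 * (polyJt n).map (logD z) * polyJt n ^ p.2) i i =
      X z * ((polyJt n ^ p.1) i z.col * polyG n p.2 z.row i) +
      X z * ((polyJt n ^ p.2) i z.col * polyG n p.1 z.row i) := by
    intro p
    rw [map_logD_polyJt, mul_add, add_mul, Matrix.add_apply]
    congr 1
    · rw [← mul_assoc, mul_assoc, single_mul_mul, polyG, polyJ_pow_mul_polyB]
    · rw [← mul_assoc, single_mul_mul, pow_mul_transpose_apply, polyJt_pow_symm p.2 i]
      ring
  simp only [h1, Finset.sum_add_distrib]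
  congr 1
  rw [← Finset.Nat.sum_antidiagonal_swap]
  rfl

theorem trace_polyJt_pow (k : ℕ) : (polyJt n ^ k).trace = polyTr n k := by
  rcases k with _ | k
  · simp [polyTr]
  · rw [polyTr, pow_succ', pow_succ, polyJt, mul_assoc, Matrix.trace_mul_comm, ← polyJt,
      ← polyJ_pow_mul_polyB, mul_assoc, polyJ]

/-- Summing over the diagonal merges `J ^ a` with `J ^ b * B` into `J ^ k * B`, whatever the
splitting `a + b = k`; there are `k + 1` equal terms. -/
theorem logD_polyTr_succ (z : Idx n) (k : ℕ) :
    logD z (polyTr n (k + 1)) =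
      2 * ((k : MvPolynomial (Idx n) ℝ) + 1) * (X z * polyG n k z.row z.col) := by
  have h1 : ∀ p ∈ antidiagonal k, ∑ i, (polyJ n ^ p.1) i z.row * polyG n p.2 i z.col =
      polyG n k z.row z.col := by
    intro p hp
    rw [← mem_antidiagonal.1 hp, polyG, polyG, pow_add, mul_assoc, Matrix.mul_apply]
    exact Finset.sum_congr rfl fun i _ => by rw [polyJ_pow_symm]
  simp only [polyTr, Matrix.trace, Matrix.diag_apply, map_sum, logD_polyJ_pow_apply,
    ← Finset.mul_sum]
  rw [Finset.sum_comm, Finset.sum_congr rfl h1, Finset.sum_const, Finset.Nat.card_antidiagonal,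
    nsmul_eq_mul]
  push_cast
  ring

/-! ### The Toda flows: Lax equation, conserved quantities, invariant volume -/

/-- The logarithmic velocity of the entry `z` under the `k`-th Toda flow. -/
def todaA (k : ℕ) (z : Idx n) : MvPolynomial (Idx n) ℝ :=
  Sum.elim (fun i => (polyJt n ^ k) i i - (polyJ n ^ k) i i)
    (fun j => (polyJ n ^ k) j.succ j.succ - (polyJt n ^ k) j.castSucc j.castSucc) z

def todaV (n k : ℕ) : Derivation ℝ (MvPolynomial (Idx n) ℝ) (MvPolynomial (Idx n) ℝ) :=
  ∑ z, todaA k z • logD z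

theorem todaV_apply (k : ℕ) (p : MvPolynomial (Idx n) ℝ) :
    todaV n k p = ∑ z, todaA k z * logD z p := by
  rw [todaV, ← Derivation.coeFnAddMonoidHom_apply, map_sum, Finset.sum_apply]
  rfl

theorem todaV_X (k : ℕ) (z : Idx n) : todaV n k (X z) = X z * todaA k z := by
  simp [todaV_apply, logD_X, mul_comm]

/-- The factor `X z * polyG n p.2 z.row z.col` is, up to a constant, the logarithmic gradient of a
trace. Summed over `z`, the divergence of the flow thus becomes a combination of derivatives of
traces along lower flows. -/
theorem logD_todaA_succ (k : ℕ) (z : Idx n) :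
    logD z (todaA (k + 1) z) = 2 * ∑ p ∈ antidiagonal k,
      todaA p.1 z * (X z * polyG n p.2 z.row z.col) := by
  rcases z with i | j
  · rw [todaA, Sum.elim_inl, map_sub, logD_polyJ_pow_apply, logD_polyJt_pow_apply, ← mul_sub,
      ← Finset.sum_sub_distrib]
    congr 1
    refine Finset.sum_congr rfl fun p _ => ?_
    simp only [Idx.row, Idx.col, todaA, Sum.elim_inl, id]
    ring
  · rw [todaA, Sum.elim_inr, map_sub, logD_polyJ_pow_apply, logD_polyJt_pow_apply, ← mul_sub,
      ← Finset.sum_sub_distrib]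
    congr 1
    refine Finset.sum_congr rfl fun p _ => ?_
    simp only [Idx.row, Idx.col, todaA, Sum.elim_inr]
    ring

/-- The skew-symmetric matrix with the same strictly lower triangular part as `M`. -/
def skewPart {R : Type*} [CommRing R] (M : Matrix (Fin (n + 1)) (Fin (n + 1)) R) :
    Matrix (Fin (n + 1)) (Fin (n + 1)) R :=
  Matrix.of fun i j => if j < i then M i j else if i < j then -M i j else 0

theorem skewPart_add_apply {R : Type*} [CommRing R] (M : Matrix (Fin (n + 1)) (Fin (n + 1)) R)
    {i j : Fin (n + 1)} (h : i < j) : (M + skewPart M) i j = 0 := by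
  simp [skewPart, h, not_lt_of_gt h]

theorem sub_skewPart_apply {R : Type*} [CommRing R] (M : Matrix (Fin (n + 1)) (Fin (n + 1)) R)
    {i j : Fin (n + 1)} (h : j < i) : (M - skewPart M) i j = 0 := by
  simp [skewPart, h]

theorem skewPart_diag {R : Type*} [CommRing R] (M : Matrix (Fin (n + 1)) (Fin (n + 1)) R)
    (i : Fin (n + 1)) : skewPart M i i = 0 := by
  simp [skewPart]

theorem skewPart_transpose {R : Type*} [CommRing R]
    {M : Matrix (Fin (n + 1)) (Fin (n + 1)) R} (h : M.transpose = M) :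
    (skewPart M).transpose = -skewPart M := by
  ext1 i j
  have : M j i = M i j := by rw [← Matrix.transpose_apply M, h]
  simp only [skewPart, Matrix.transpose_apply, Matrix.of_apply, Matrix.neg_apply, this]
  split_ifs with h1 h2 <;> first | simp | (exfalso; omega)

/-- Since `B * Jt ^ k = J ^ k * B`, adding or subtracting these powers leaves the right side
unchanged. With `+` the factors are lower triangular; with `-` they are upper triangular, so nothing
lies below the first subdiagonal. Hence the right side is lower bidiagonal, and each of its two
diagonals is read off from the form in which only one product survives. -/
theorem map_todaV_polyB (k : ℕ) : (polyB n).map (todaV n k) =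
    polyB n * skewPart (polyJt n ^ k) - skewPart (polyJ n ^ k) * polyB n := by
  set M := polyJ n ^ k with hM
  set Mt := polyJt n ^ k with hMt
  have hBM : polyB n * Mt = M * polyB n := (polyJ_pow_mul_polyB k).symm
  have hl : polyB n * skewPart Mt - skewPart M * polyB n =
      polyB n * (Mt + skewPart Mt) - (M + skewPart M) * polyB n := by
    rw [mul_add, add_mul, hBM]; abel
  have hu : polyB n * skewPart Mt - skewPart M * polyB n =
      (M - skewPart M) * polyB n - polyB n * (Mt - skewPart Mt) := by
    rw [mul_sub, sub_mul, hBM]; abel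
  ext1 i j
  rw [Matrix.map_apply]
  rcases lt_trichotomy i j with h | rfl | h
  · rw [hl, polyB_eq_zero h.ne (by omega), map_zero, Matrix.sub_apply, Matrix.mul_apply,
      Matrix.mul_apply, Finset.sum_eq_zero, Finset.sum_eq_zero, sub_zero]
    · intro l _
      rcases lt_or_ge i l with h1 | h1
      · rw [skewPart_add_apply _ h1, zero_mul]
      · rw [polyB_eq_zero (by omega) (by omega), mul_zero]
    · intro l _
      rcases lt_or_ge i l with h1 | h1
      · rw [polyB_eq_zero (by omega) (by omega), zero_mul]
      · rw [skewPart_add_apply _ (by omega), mul_zero]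
  · rw [hl, Matrix.sub_apply, Matrix.mul_apply, Matrix.mul_apply, Finset.sum_eq_single i,
      Finset.sum_eq_single i]
    · have := polyB_row_col (Sum.inl i : Idx n)
      simp only [Idx.row, Idx.col, Sum.elim_inl, id] at this
      rw [this, todaV_X, Matrix.add_apply, Matrix.add_apply, skewPart_diag, skewPart_diag]
      simp only [todaA, Sum.elim_inl, ← hM, ← hMt]
      ring
    · intro l _ hl
      rcases lt_or_gt_of_ne hl with h1 | h1
      · rw [polyB_eq_zero (by omega) (by omega), mul_zero]
      · rw [skewPart_add_apply _ h1, zero_mul]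
    · simp
    · intro l _ hl
      rcases lt_or_gt_of_ne hl with h1 | h1
      · rw [skewPart_add_apply _ h1, mul_zero]
      · rw [polyB_eq_zero (by omega) (by omega), zero_mul]
    · simp
  · by_cases hij : (i : ℕ) = j + 1
    · rw [hu, Matrix.sub_apply, Matrix.mul_apply, Matrix.mul_apply, Finset.sum_eq_single i,
        Finset.sum_eq_single j]
      · obtain ⟨z, hz⟩ : ∃ z : Fin n, i = z.succ ∧ j = z.castSucc :=
          ⟨⟨j, by omega⟩, by ext; simp [hij], by ext; simp⟩
        have := polyB_row_col (Sum.inr z : Idx n)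
        simp only [Idx.row, Idx.col, Sum.elim_inr, ← hz.1, ← hz.2] at this
        rw [this, todaV_X, Matrix.sub_apply, Matrix.sub_apply, skewPart_diag, skewPart_diag]
        simp only [todaA, Sum.elim_inr, ← hM, ← hMt, ← hz.1, ← hz.2]
        ring
      · intro l _ hl
        rcases lt_or_ge j l with h1 | h1
        · rw [sub_skewPart_apply _ h1, mul_zero]
        · rw [polyB_eq_zero (by omega) (by omega), zero_mul]
      · simp
      · intro l _ hl
        rcases lt_or_ge l i with h1 | h1
        · rw [sub_skewPart_apply _ h1, zero_mul]
        · rw [polyB_eq_zero (by omega) (by omega), mul_zero]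
      · simp
    · rw [hu, polyB_eq_zero h.ne' hij, map_zero, Matrix.sub_apply, Matrix.mul_apply,
        Matrix.mul_apply, Finset.sum_eq_zero, Finset.sum_eq_zero, sub_zero]
      · intro l _
        rcases lt_or_ge j l with h1 | h1
        · rw [sub_skewPart_apply _ h1, mul_zero]
        · rw [polyB_eq_zero (by omega) (by omega), zero_mul]
      · intro l _
        rcases lt_or_ge l i with h1 | h1
        · rw [sub_skewPart_apply _ h1, zero_mul]
        · rw [polyB_eq_zero (by omega) (by omega), mul_zero]

/-- The skew part of `Jt ^ k` cancels between `B` and its transpose, which leaves the Lax equation.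
-/
theorem map_todaV_polyJ (k : ℕ) : (polyJ n).map (todaV n k) =
    polyJ n * skewPart (polyJ n ^ k) - skewPart (polyJ n ^ k) * polyJ n := by
  have h1 : (polyJ n ^ k).transpose = polyJ n ^ k := by
    rw [Matrix.transpose_pow, polyJ_transpose]
  have h2 : (polyJt n ^ k).transpose = polyJt n ^ k := by
    rw [Matrix.transpose_pow, polyJt_transpose]
  conv_lhs => rw [polyJ]
  rw [map_derivation_mul, Matrix.transpose_map, map_todaV_polyB, Matrix.transpose_sub,
    Matrix.transpose_mul, Matrix.transpose_mul, skewPart_transpose h1, skewPart_transpose h2, polyJ]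
  noncomm_ring

theorem todaV_polyTr (k l : ℕ) : todaV n k (polyTr n l) = 0 := by
  have : todaV n k (polyTr n l) = ((polyJ n ^ l).map (todaV n k)).trace := by
    simp [polyTr, Matrix.trace]
  rw [this, map_derivation_pow_of_commutator _ (map_todaV_polyJ k), Matrix.trace_sub,
    Matrix.trace_mul_comm, sub_self]

/-- The commutator involves only the first row and column of the skew part. Off the corner these are
the entries of `J ^ k` up to sign; the vanishing corner accounts for the quadratic correction. -/
theorem todaV_polyF (k l : ℕ) :
    todaV n k (polyF n l) = 2 * (polyF n (k + l) - polyF n k * polyF n l) := by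
  have h : ∀ i, i ≠ 0 → skewPart (polyJ n ^ k) i 0 = (polyJ n ^ k) i 0 ∧
      skewPart (polyJ n ^ k) 0 i = -(polyJ n ^ k) i 0 := by
    intro i hi
    have : 0 < i := Fin.pos_of_ne_zero hi
    refine ⟨by simp [skewPart, this], ?_⟩
    rw [polyJ_pow_symm k i]
    simp [skewPart, this]
  rw [polyF, ← Matrix.map_apply (f := todaV n k) (M := polyJ n ^ l),
    map_derivation_pow_of_commutator _ (map_todaV_polyJ k), Matrix.sub_apply, Matrix.mul_apply,
    Matrix.mul_apply, polyF, add_comm k l, pow_add, Matrix.mul_apply, ← Finset.sum_sub_distrib,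
    ← Finset.add_sum_erase _ _ (mem_univ 0), ← Finset.add_sum_erase _ _ (mem_univ 0),
    skewPart_diag, polyF]
  have : ∑ x ∈ univ.erase 0, ((polyJ n ^ l) 0 x * skewPart (polyJ n ^ k) x 0 -
      skewPart (polyJ n ^ k) 0 x * (polyJ n ^ l) x 0) =
      2 * ∑ x ∈ univ.erase 0, (polyJ n ^ l) 0 x * (polyJ n ^ k) x 0 := by
    rw [Finset.mul_sum]
    refine Finset.sum_congr rfl fun x hx => ?_
    rw [(h x (Finset.ne_of_mem_erase hx)).1, (h x (Finset.ne_of_mem_erase hx)).2,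
      polyJ_pow_symm l x]
    ring
  rw [this]
  ring

theorem todaA_zero (z : Idx n) : todaA 0 z = 0 := by
  rcases z with i | j <;> simp [todaA]

/-- The Toda flows preserve the logarithmic volume. -/
theorem sum_logD_todaA (k : ℕ) : ∑ z, logD z (todaA (n := n) k z) = 0 := by
  rcases k with _ | k
  · simp [todaA_zero]
  · simp only [logD_todaA_succ, ← Finset.mul_sum]
    rw [Finset.sum_comm, Finset.sum_eq_zero, mul_zero]
    intro p _
    -- Conservation of a trace, expanded by its gradient, is the required vanishing up to the factor
    -- `2 * (p.2 + 1)`.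
    have h := todaV_polyTr (n := n) p.1 (p.2 + 1)
    rw [todaV_apply, Finset.sum_congr rfl fun z _ => by rw [logD_polyTr_succ]] at h
    have h2 : (2 * ((p.2 : MvPolynomial (Idx n) ℝ) + 1)) ≠ 0 := by
      have : ((2 * (p.2 + 1) : ℕ) : MvPolynomial (Idx n) ℝ) ≠ 0 := Nat.cast_ne_zero.2 (by positivity)
      simpa using this
    have h3 : (2 * ((p.2 : MvPolynomial (Idx n) ℝ) + 1)) *
        ∑ z, todaA p.1 z * (X z * polyG n p.2 z.row z.col) = 0 := by
      rw [← h, Finset.mul_sum]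
      exact Finset.sum_congr rfl fun z _ => by ring
    exact (mul_eq_zero.1 h3).resolve_left h2

theorem polyTr_one : polyTr n 1 = ∑ z, X z ^ 2 := by
  have h : polyTr n 1 = ∑ p : Fin (n + 1) × Fin (n + 1), polyB n p.1 p.2 ^ 2 := by
    simp [polyTr, polyJ, Matrix.trace, Matrix.mul_apply, Fintype.sum_prod_type, pow_two]
  rw [h]
  symm
  refine Fintype.sum_of_injective (fun z : Idx n => (z.row, z.col)) ?_ _ _ ?_ ?_
  · intro z w hzw
    exact idx_ext (congrArg Prod.fst hzw) (congrArg Prod.snd hzw)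
  · rintro ⟨i, j⟩ hij
    rw [polyB_eq_zero, zero_pow two_ne_zero]
    · exact fun h => hij ⟨_, Prod.ext (exists_idx (Or.inl h)).choose_spec.1
        (exists_idx (Or.inl h)).choose_spec.2⟩
    · exact fun h => hij ⟨_, Prod.ext (exists_idx (Or.inr h)).choose_spec.1
        (exists_idx (Or.inr h)).choose_spec.2⟩
  · intro z
    rw [polyB_row_col]

/-- The sum of the squared entries is `tr J`, a conserved quantity, so the Gaussian weight is
invariant under the flow. -/
theorem sum_sq_mul_todaA (k : ℕ) : ∑ z, X z ^ 2 * todaA (n := n) k z = 0 := by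
  have h := todaV_polyTr (n := n) k 1
  rw [polyTr_one, map_sum] at h
  have : ∀ z : Idx n, todaV n k (X z ^ 2) = 2 * (X z ^ 2 * todaA k z) := by
    intro z
    rw [Derivation.leibniz_pow, todaV_X]
    simp
    ring
  simp only [this, ← Finset.mul_sum] at h
  exact (mul_eq_zero.1 h).resolve_left two_ne_zero

theorem polyF_succ (k : ℕ) : polyF n (k + 1) = polyG n k 0 0 * X (Sum.inl 0) := by
  have h : polyJ n ^ (k + 1) = polyG n k * (polyB n).transpose := by
    rw [pow_succ, polyG, mul_assoc, polyJ]
  rw [polyF, h, Matrix.mul_apply, Finset.sum_eq_single 0]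
  · have := polyB_row_col (Sum.inl 0 : Idx n)
    simp only [Idx.row, Idx.col, Sum.elim_inl, id] at this
    rw [Matrix.transpose_apply, this]
  · intro b _ hb
    rw [Matrix.transpose_apply, polyB_eq_zero hb.symm (by simp), mul_zero]
  · simp

theorem polyF_one : polyF n 1 = X (Sum.inl 0) ^ 2 := by
  have := polyB_row_col (Sum.inl 0 : Idx n)
  simp only [Idx.row, Idx.col, Sum.elim_inl, id] at this
  rw [polyF_succ, polyG, pow_zero, one_mul, this, pow_two]

/-- For the upper left entry, row and column are both `0`, and `B` has no other entry in its first
row; hence the derivative stays within the algebra generated by the `polyF`. -/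
theorem logD_zero_polyF (r : ℕ) : logD (Sum.inl 0 : Idx n) (polyF n r) =
    2 * ∑ l ∈ range r, polyF n l * polyF n (r - l) := by
  rcases r with _ | r
  · simp [polyF]
  · rw [polyF, logD_polyJ_pow_apply, Finset.Nat.sum_antidiagonal_eq_sum_range_succ_mk]
    congr 1
    refine Finset.sum_congr rfl fun l hl => ?_
    rw [Nat.succ_sub (Nat.le_of_lt_succ (mem_range.1 hl))]
    simp only [polyF, Idx.row, Idx.col, Sum.elim_inl, id]
    rw [show (polyJ n ^ (r - l).succ) 0 0 = _ from polyF_succ (r - l)]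
    ring

theorem logD_zero_polyTr (k : ℕ) :
    logD (Sum.inl 0 : Idx n) (polyTr n k) = 2 * (k * polyF n k) := by
  rcases k with _ | k
  · simp [polyTr]
  · rw [logD_polyTr_succ, polyF_succ]
    simp only [Idx.row, Idx.col, Sum.elim_inl, id]
    push_cast
    ring

/-- The Euler field. -/
def eulerD (n : ℕ) : Derivation ℝ (MvPolynomial (Idx n) ℝ) (MvPolynomial (Idx n) ℝ) :=
  ∑ z, logD z

theorem eulerD_apply (p : MvPolynomial (Idx n) ℝ) : eulerD n p = ∑ z, logD z p := by
  rw [eulerD, ← Derivation.coeFnAddMonoidHom_apply, map_sum, Finset.sum_apply]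
  rfl

theorem map_eulerD_polyB : (polyB n).map (eulerD n) = polyB n := by
  ext1 i j
  rw [Matrix.map_apply]
  by_cases h : i = j ∨ (i : ℕ) = j + 1
  · obtain ⟨w, rfl, rfl⟩ := exists_idx h
    rw [polyB_row_col, eulerD_apply]
    simp [logD_X]
  · push Not at h
    rw [polyB_eq_zero h.1 h.2, map_zero]

theorem map_eulerD_polyJ : (polyJ n).map (eulerD n) = (2 : ℝ) • polyJ n := by
  conv_lhs => rw [polyJ]
  rw [map_derivation_mul, Matrix.transpose_map, map_eulerD_polyB, polyJ, two_smul]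

theorem eulerD_polyF (k : ℕ) : eulerD n (polyF n k) = (k * 2 : ℝ) • polyF n k := by
  rw [polyF, ← Matrix.map_apply (f := eulerD n) (M := polyJ n ^ k),
    map_derivation_pow_of_smul _ _ map_eulerD_polyJ]
  rfl

theorem eulerD_polyTr (k : ℕ) : eulerD n (polyTr n k) = (k * 2 : ℝ) • polyTr n k := by
  have : eulerD n (polyTr n k) = ((polyJ n ^ k).map (eulerD n)).trace := by
    simp [polyTr, Matrix.trace]
  rw [this, map_derivation_pow_of_smul _ _ map_eulerD_polyJ, Matrix.trace_smul, polyTr]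

/-- The products of the power sums of the eigenvalues. -/
def polyProd (n : ℕ) (L : Multiset ℕ) : MvPolynomial (Idx n) ℝ := (L.map (polyTr n)).prod

@[simp] theorem polyProd_zero : polyProd n 0 = 1 := by simp [polyProd]

@[simp] theorem polyProd_cons (k : ℕ) (L : Multiset ℕ) :
    polyProd n (k ::ₘ L) = polyTr n k * polyProd n L := by simp [polyProd]

theorem todaV_polyProd (k : ℕ) (L : Multiset ℕ) : todaV n k (polyProd n L) = 0 := by
  induction L using Multiset.induction_on with
  | empty => simp
  | cons l L ih => rw [polyProd_cons, Derivation.leibniz, ih, todaV_polyTr]; simp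

theorem eulerD_polyProd (L : Multiset ℕ) :
    eulerD n (polyProd n L) = (L.sum * 2 : ℝ) • polyProd n L := by
  induction L using Multiset.induction_on with
  | empty => simp
  | cons l L ih =>
    rw [polyProd_cons, Derivation.leibniz, ih, eulerD_polyTr, Multiset.sum_cons]
    simp only [smul_eq_mul, Algebra.smul_def]
    simp only [Nat.cast_add, map_add, map_mul]
    ring

theorem logD_zero_polyProd (L : Multiset ℕ) : logD (Sum.inl 0 : Idx n) (polyProd n L) =
    2 * (L.map fun k : ℕ => (k : MvPolynomial (Idx n) ℝ) * polyF n k * polyProd n (L.erase k)).sum := by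
  induction L using Multiset.induction_on with
  | empty => simp
  | cons l L ih =>
    rw [polyProd_cons, Derivation.leibniz, ih, logD_zero_polyTr, Multiset.map_cons,
      Multiset.sum_cons, Multiset.erase_cons_head]
    have : (L.map fun k : ℕ => (k : MvPolynomial (Idx n) ℝ) * polyF n k *
        polyProd n ((l ::ₘ L).erase k)) = L.map fun k : ℕ => polyTr n l *
          ((k : MvPolynomial (Idx n) ℝ) * polyF n k * polyProd n (L.erase k)) := by
      refine Multiset.map_congr rfl fun k hk => ?_
      rw [Multiset.erase_cons_tail_of_mem hk, polyProd_cons]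
      ring
    rw [this, Multiset.sum_map_mul_left]
    simp only [smul_eq_mul]
    ring

/-! ### Integration by parts and the loop equation -/

section Expectation

/-- The numbers of degrees of freedom of the entries of the bidiagonal matrix. -/
def dof (κ α : ℝ) (z : Idx n) : ℝ :=
  Sum.elim (fun i : Fin (n + 1) => 2 * α + 2 + 2 * κ * (n - (i : ℕ)))
    (fun j : Fin n => 2 * κ * (n - (j : ℕ))) z

theorem sum_dof (κ α : ℝ) : ∑ z : Idx n, dof κ α z =
    2 * ((n + 1) * (α + 1) + κ * n * (n + 1)) := by
  have h : ∀ m : ℕ, ∑ i : Fin m, ((i : ℕ) : ℝ) = m * (m - 1) / 2 := by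
    intro m
    induction m with
    | zero => simp
    | succ m ih => rw [Fin.sum_univ_castSucc]; simp [ih]; ring
  simp only [dof, Fintype.sum_sum_type, Sum.elim_inl, Sum.elim_inr, Finset.sum_add_distrib,
    ← Finset.mul_sum, Finset.sum_sub_distrib, h]
  simp
  ring

/-- This is where the particular degrees of freedom matter. The constant `2α + 2` drops out because
`J ^ k` and `Jt ^ k` have equal traces. The `Jt` terms cancel between a diagonal entry and the
subdiagonal entry below it; the `J` terms carry weights differing by `2κ`, except at the corner. -/
theorem sum_dof_mul_todaA (κ α : ℝ) (k : ℕ) : ∑ z : Idx n, dof κ α z • todaA k z =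
    (2 * κ) • (polyTr n k - (n + 1 : ℝ) • polyF n k) := by
  have ht : ∑ i, (polyJt n ^ k) i i = ∑ i, (polyJ n ^ k) i i := trace_polyJt_pow k
  simp only [Fintype.sum_sum_type, dof, todaA, Sum.elim_inl, Sum.elim_inr]
  have h1 : ∑ i : Fin (n + 1), (2 * α + 2 + 2 * κ * (n - (i : ℕ))) •
      ((polyJt n ^ k) i i - (polyJ n ^ k) i i) =
      ∑ i : Fin (n + 1), (2 * κ * (n - (i : ℕ))) • ((polyJt n ^ k) i i - (polyJ n ^ k) i i) := by
    simp only [add_smul _ (2 * κ * _), Finset.sum_add_distrib, ← Finset.smul_sum]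
    rw [Finset.sum_sub_distrib, ht]
    simp
  rw [h1]
  simp only [smul_sub, Finset.sum_sub_distrib]
  rw [Fin.sum_univ_castSucc (fun i : Fin (n + 1) =>
    (2 * κ * (n - (i : ℕ))) • (polyJt n ^ k) i i), polyTr, polyF, Matrix.trace,
    Fin.sum_univ_succ, Fin.sum_univ_succ]
  simp only [Fin.val_castSucc, Fin.val_last, sub_self, mul_zero, zero_smul, add_zero,
    Fin.val_zero, Nat.cast_zero, sub_zero, Fin.val_succ, Matrix.diag_apply, smul_add,
    Finset.smul_sum]
  have h2 : ∑ i : Fin n, (2 * κ * (n - (i : ℕ))) • (polyJ n ^ k) i.succ i.succ =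
      ∑ i : Fin n, (2 * κ * (n - (i + 1 : ℕ))) • (polyJ n ^ k) i.succ i.succ +
      ∑ i : Fin n, (2 * κ) • (polyJ n ^ k) i.succ i.succ := by
    rw [← Finset.sum_add_distrib]
    refine Finset.sum_congr rfl fun i _ => ?_
    rw [← add_smul]
    push_cast
    congr 1
    ring
  rw [h2]
  module

variable {κ α : ℝ} {E : MvPolynomial (Idx n) ℝ →ₗ[ℝ] ℝ}

/-- The integration by parts formula for functions of independent chi variables. -/
def IntByParts (κ α : ℝ) (E : MvPolynomial (Idx n) ℝ →ₗ[ℝ] ℝ) : Prop :=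
  ∀ (z : Idx n) (h : MvPolynomial (Idx n) ℝ),
    E (logD z h) = 2 * E (X z ^ 2 * h) - dof κ α z * E h

/-- Integrate by parts along the flow: its divergence and its action on the Gaussian exponent
vanish, so only the power weight contributes. -/
theorem expect_todaV (hE : IntByParts κ α E) (k : ℕ) (h : MvPolynomial (Idx n) ℝ) :
    E (todaV n k h) = 2 * κ * ((n + 1) * E (polyF n k * h) - E (polyTr n k * h)) := by
  have h1 : ∑ z, E (logD z (todaA k z * h)) = E (todaV n k h) := by
    rw [← map_sum]
    congr 1
    simp only [Derivation.leibniz, smul_eq_mul, Finset.sum_add_distrib, ← Finset.mul_sum,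
      sum_logD_todaA, mul_zero, add_zero, todaV_apply]
  rw [← h1]
  simp only [hE _ _, Finset.sum_sub_distrib, ← Finset.mul_sum, ← mul_assoc]
  rw [← map_sum, ← Finset.sum_mul, sum_sq_mul_todaA]
  have h2 : ∑ z, dof κ α z * E (todaA k z * h) = E ((∑ z, dof κ α z • todaA k z) * h) := by
    rw [Finset.sum_mul, map_sum]
    simp
  rw [h2, sum_dof_mul_todaA]
  simp [sub_mul]
  ring

/-- The expected normalized trace equals the expected upper left entry. -/
theorem expect_polyF_mul (hκ : κ ≠ 0) (hE : IntByParts κ α E) (k : ℕ) (L : Multiset ℕ) :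
    (n + 1) * E (polyF n k * polyProd n L) = E (polyProd n (k ::ₘ L)) := by
  have h := expect_todaV hE k (polyProd n L)
  -- Products of traces are constant along the flow, so the right side must vanish; `κ ≠ 0` allows
  -- the division.
  rw [todaV_polyProd, map_zero, eq_comm, mul_eq_zero] at h
  rw [polyProd_cons]
  exact sub_eq_zero.1 (h.resolve_left (by simpa using hκ))

theorem expect_polyF_mul_polyF (hE : IntByParts κ α E) (k l : ℕ)
    (L : Multiset ℕ) : ((n + 1) * κ + 1) * E (polyF n k * polyF n l * polyProd n L) =
      κ * E (polyF n k * polyProd n (l ::ₘ L)) + E (polyF n (k + l) * polyProd n L) := by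
  have h := expect_todaV hE l (polyF n k * polyProd n L)
  rw [Derivation.leibniz, todaV_polyProd, todaV_polyF, smul_zero, zero_add, smul_eq_mul] at h
  have h1 : polyProd n L * (2 * (polyF n (l + k) - polyF n l * polyF n k)) =
      (2 : ℝ) • (polyF n (k + l) * polyProd n L - polyF n k * polyF n l * polyProd n L) := by
    rw [two_smul, add_comm l k]
    ring
  have h2 : polyF n l * (polyF n k * polyProd n L) = polyF n k * polyF n l * polyProd n L := by
    ring
  have h3 : polyTr n l * (polyF n k * polyProd n L) = polyF n k * polyProd n (l ::ₘ L) := by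
    rw [polyProd_cons]; ring
  rw [h1, h2, h3, map_smul, map_sub, smul_eq_mul] at h
  linarith

theorem expect_multiset_sum {ι : Type*} (E : MvPolynomial (Idx n) ℝ →ₗ[ℝ] ℝ) (s : Multiset ι)
    (f : ι → MvPolynomial (Idx n) ℝ) : E (s.map f).sum = (s.map fun i => E (f i)).sum := by
  rw [map_multiset_sum, Multiset.map_map]
  rfl

/-- The loop equation. -/
theorem expect_recurrence (hE : IntByParts κ α E) (r : ℕ) (L : Multiset ℕ) :
    E (polyF n (r + 1) * polyProd n L) =
      (α + 1 + r + κ * n - κ * r) * E (polyF n r * polyProd n L) +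
      κ * ∑ l ∈ range r, E (polyF n l * polyProd n ((r - l) ::ₘ L)) +
      (L.map fun k : ℕ => k * E (polyF n (r + k) * polyProd n (L.erase k))).sum := by
  -- Integration by parts in the upper left entry, where `X ^ 2 = polyF n 1`. The next identity sums
  -- the formula over all entries and serves to evaluate the term with an extra `tr J`.
  have hS := hE (Sum.inl 0) (polyF n r * polyProd n L)
  have hEu : E (eulerD n (polyF n r * polyProd n L)) =
      2 * E (polyF n r * polyProd n (1 ::ₘ L)) -
        2 * ((n + 1) * (α + 1) + κ * n * (n + 1)) * E (polyF n r * polyProd n L) := by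
    rw [eulerD_apply, map_sum, Finset.sum_congr rfl fun z _ => hE z _, Finset.sum_sub_distrib,
      ← Finset.mul_sum, ← Finset.sum_mul, sum_dof, ← map_sum, ← Finset.sum_mul, ← polyTr_one,
      polyProd_cons]
    congr 3
    ring
  have hEu2 : eulerD n (polyF n r * polyProd n L) =
      ((r + L.sum) * 2 : ℝ) • (polyF n r * polyProd n L) := by
    rw [Derivation.leibniz, eulerD_polyF, eulerD_polyProd]
    simp only [smul_eq_mul, Algebra.smul_def]
    simp only [map_add, map_mul]
    ring
  rw [hEu2, map_smul, smul_eq_mul] at hEu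
  have hdof : dof κ α (Sum.inl 0 : Idx n) = 2 * α + 2 + 2 * κ * n := by simp [dof]
  have hl : logD (Sum.inl 0) (polyF n r * polyProd n L) = (2 : ℝ) •
      ((∑ l ∈ range r, polyF n l * polyF n (r - l) * polyProd n L) +
      (L.map fun k : ℕ => (k : ℝ) • (polyF n r * polyF n k * polyProd n (L.erase k))).sum) := by
    rw [Derivation.leibniz, logD_zero_polyF, logD_zero_polyProd]
    have : (L.map fun k : ℕ => (k : ℝ) • (polyF n r * polyF n k * polyProd n (L.erase k))) =
        L.map fun k : ℕ => polyF n r *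
          ((k : MvPolynomial (Idx n) ℝ) * polyF n k * polyProd n (L.erase k)) := by
      refine Multiset.map_congr rfl fun k _ => ?_
      rw [Algebra.smul_def, map_natCast]
      ring
    rw [this, Multiset.sum_map_mul_left, ← Finset.sum_mul, two_smul]
    simp only [smul_eq_mul]
    ring
  rw [hl, ← polyF_one, ← mul_assoc, hdof, map_smul, smul_eq_mul, map_add, map_sum,
    expect_multiset_sum] at hS
  simp only [map_smul, smul_eq_mul] at hS
  have hS' : ((n + 1) * κ + 1) *
      ((∑ l ∈ range r, E (polyF n l * polyF n (r - l) * polyProd n L)) +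
      (L.map fun k : ℕ => (k : ℝ) * E (polyF n r * polyF n k * polyProd n (L.erase k))).sum) =
      ∑ l ∈ range r, (κ * E (polyF n l * polyProd n ((r - l) ::ₘ L)) +
        E (polyF n r * polyProd n L)) + (L.map fun k : ℕ => κ * E (polyF n r * polyProd n L) * k +
          k * E (polyF n (r + k) * polyProd n (L.erase k))).sum := by
    rw [mul_add, Finset.mul_sum, ← Multiset.sum_map_mul_left]
    congr 1
    · refine Finset.sum_congr rfl fun l hl => ?_
      rw [expect_polyF_mul_polyF hE, Nat.add_sub_cancel' (mem_range.1 hl).le]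
    · congr 1
      refine Multiset.map_congr rfl fun k hk => ?_
      rw [mul_left_comm, expect_polyF_mul_polyF hE, Multiset.cons_erase hk]
      ring
  have hF := expect_polyF_mul_polyF hE r 1 L
  have hsum : (L.map fun k : ℕ => (k : ℝ)).sum = L.sum := by
    rw [← Nat.cast_multiset_sum]
  rw [Multiset.sum_map_add, Multiset.sum_map_mul_left, hsum, Finset.sum_add_distrib,
    ← Finset.mul_sum, Finset.sum_const, card_range, nsmul_eq_mul] at hS'
  rw [mul_comm (polyF n 1)] at hS
  generalize E (polyF n r * polyF n 1 * polyProd n L) = e1 at *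
  generalize E (polyF n r * polyProd n L) = e0 at *
  generalize E (polyF n r * polyProd n (1 ::ₘ L)) = e2 at *
  -- The factor on `hS` makes its products of two `polyF` match those in `hS'` and `hF`; `κ / 2 *
  -- hEu` then removes the expectation containing `tr J`.
  linear_combination (-(((n : ℝ) + 1) * κ + 1) / 2) * hS + hS' - hF + κ / 2 * hEu

end Expectation

end

end BetaLaguerre

/-! ### Passage to the limit in the loop equation -/

namespace BetaLaguerre

open MvPolynomial Finset Matrix

noncomputable section

theorem polyF_zero (n : ℕ) : polyF n 0 = 1 := by simp [polyF]

/-- The recurrence for the moments of the associated Laguerre polynomials. -/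
structure MomentRec (α c : ℝ) (m : ℕ → ℝ) : Prop where
  zero : m 0 = 1
  succ : ∀ r, m (r + 1) = (α + 1 + r + c) * m r + c * ∑ l ∈ range r, m l * m (r - l)

/-- The products of traces are indispensable, since the recurrence generates them even from `L = 0`.
The outer induction is on the total degree `j + L.sum`, which the recurrence lowers by one. -/
theorem tendsto_expect {α c : ℝ} {m : ℕ → ℝ} (hm : MomentRec α c m) {κ : ℕ → ℝ}
    {E : ∀ n, MvPolynomial (Idx n) ℝ →ₗ[ℝ] ℝ} (hE : ∀ n, IntByParts (κ n) α (E n))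
    (hE1 : ∀ n, E n 1 = 1) (hκ : ∀ n, κ n ≠ 0)
    (hc : Tendsto (fun n : ℕ => ((n : ℝ) + 1) * κ n) atTop (𝓝 c)) (j : ℕ) (L : Multiset ℕ) :
    Tendsto (fun n => E n (polyF n j * polyProd n L) / ((n : ℝ) + 1) ^ L.card) atTop
      (𝓝 (m j * (L.map m).prod)) := by
  have hinv : Tendsto (fun n : ℕ => 1 / ((n : ℝ) + 1)) atTop (𝓝 0) :=
    tendsto_one_div_add_atTop_nhds_zero_nat
  have hpos : ∀ n : ℕ, (n : ℝ) + 1 ≠ 0 := fun n => by positivity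
  have hκ0 : Tendsto κ atTop (𝓝 0) := by
    have := hinv.mul hc
    rw [zero_mul] at this
    refine this.congr fun n => ?_
    have := hpos n
    field_simp
  have hκn : Tendsto (fun n : ℕ => κ n * n) atTop (𝓝 c) := by
    have := hc.sub hκ0
    rw [sub_zero] at this
    refine this.congr fun n => ?_
    ring
  have main : ∀ D : ℕ, ∀ (j : ℕ) (L : Multiset ℕ), j + L.sum = D →
      Tendsto (fun n => E n (polyF n j * polyProd n L) / ((n : ℝ) + 1) ^ L.card) atTop
        (𝓝 (m j * (L.map m).prod)) := by
    intro D
    induction D using Nat.strong_induction_on with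
    | _ D ih =>
    have hstep : ∀ (r : ℕ) (L : Multiset ℕ), r + 1 + L.sum = D →
        Tendsto (fun n => E n (polyF n (r + 1) * polyProd n L) / ((n : ℝ) + 1) ^ L.card) atTop
          (𝓝 (m (r + 1) * (L.map m).prod)) := by
      intro r L hr
      have h1 : Tendsto (fun n : ℕ => (α + 1 + r + κ n * n - κ n * r) *
          (E n (polyF n r * polyProd n L) / ((n : ℝ) + 1) ^ L.card)) atTop
          (𝓝 ((α + 1 + r + c - 0 * r) * (m r * (L.map m).prod))) :=
        ((tendsto_const_nhds.add hκn).sub (hκ0.mul_const _)).mul (ih (r + L.sum) (by omega) _ _ rfl)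
      have h2 : Tendsto (fun n : ℕ => (((n : ℝ) + 1) * κ n) * ∑ l ∈ range r,
          E n (polyF n l * polyProd n ((r - l) ::ₘ L)) /
            ((n : ℝ) + 1) ^ ((r - l) ::ₘ L).card) atTop
          (𝓝 (c * ∑ l ∈ range r, m l * (((r - l) ::ₘ L).map m).prod)) := by
        refine hc.mul (tendsto_finsetSum _ fun l hl => ih (r + L.sum) (by omega) _ _ ?_)
        have := mem_range.1 hl
        rw [Multiset.sum_cons]
        omega
      -- These terms have lost a trace without gaining a factor `κ`, so a power of `1 / (n + 1)` is
      -- left over and they vanish. This is why the limits factorize.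
      have h3 : Tendsto (fun n : ℕ => (L.map fun k : ℕ => 1 / ((n : ℝ) + 1) * (k *
          (E n (polyF n (r + k) * polyProd n (L.erase k)) /
            ((n : ℝ) + 1) ^ (L.erase k).card))).sum) atTop
          (𝓝 (L.map fun k : ℕ => 0 * (k * (m (r + k) * ((L.erase k).map m).prod))).sum) := by
        refine tendsto_multiset_sum L fun k hk => hinv.mul (tendsto_const_nhds.mul
          (ih (r + L.sum) (by omega) _ _ ?_))
        have := Multiset.sum_erase hk
        omega
      convert (h1.add h2).add h3 using 1
      · ext n
        rw [expect_recurrence (hE n), add_div, add_div, mul_div_assoc]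
        congr 2
        · rw [mul_comm ((n : ℝ) + 1), mul_assoc, mul_div_assoc, Finset.sum_div,
            Finset.mul_sum _ _ ((n : ℝ) + 1)]
          congr 1
          refine Finset.sum_congr rfl fun l _ => ?_
          have := hpos n
          rw [Multiset.card_cons, pow_succ]
          field_simp
        · rw [div_eq_mul_inv, ← Multiset.sum_map_mul_right]
          congr 1
          refine Multiset.map_congr rfl fun k hk => ?_
          have := hpos n
          rw [← Multiset.card_erase_add_one hk, pow_succ]
          field_simp
      · congr 1
        simp only [zero_mul, Multiset.map_const', Multiset.sum_replicate, smul_zero, hm.succ,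
          Multiset.map_cons, Multiset.prod_cons, ← mul_assoc]
        rw [← Finset.sum_mul]
        ring
    intro j L
    -- For `j = 0` a trace is traded for an upper left entry, which keeps the degree. The traded
    -- exponent may again be `0`, hence a second induction on the number of factors.
    induction h : L.card using Nat.strong_induction_on generalizing j L with
    | _ s ihs =>
    intro hD
    subst h
    rcases j with _ | r
    · obtain rfl | ⟨k, hk⟩ := L.empty_or_exists_mem
      · simp [polyF_zero, hE1, hm.zero]
      · obtain ⟨L, rfl⟩ := Multiset.exists_cons_of_mem hk
        have key : ∀ n, E n (polyF n 0 * polyProd n (k ::ₘ L)) /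
            ((n : ℝ) + 1) ^ (k ::ₘ L).card =
            E n (polyF n k * polyProd n L) / ((n : ℝ) + 1) ^ L.card := by
          intro n
          have := hpos n
          rw [polyF_zero, one_mul, ← expect_polyF_mul (hκ n) (hE n), Multiset.card_cons, pow_succ]
          field_simp
        rw [Multiset.sum_cons] at hD
        simp only [key, Multiset.map_cons, Multiset.prod_cons, hm.zero, one_mul]
        exact ihs L.card (by simp) k L rfl (by omega)
    · exact hstep r L hD
  exact main _ j L rfl

end

end BetaLaguerre

/-! ### The moments of the associated Laguerre Jacobi matrix -/

namespace BetaLaguerre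

open Finset

noncomputable section

/-- The diagonal of `assocLaguerreJ α c`. -/
def assocDiag (α c : ℝ) : ℕ → ℝ
  | 0 => α + c + 1
  | n + 1 => (α + c + (n + 2)) + (c + (n + 1))

/-- The off-diagonal of `assocLaguerreJ α c`. -/
def assocOff (α c : ℝ) (n : ℕ) : ℝ := √(c + (n + 1)) * √(α + c + (n + 1))

theorem assocOff_sq {α c : ℝ} (hα : -1 < α) (hc : 0 ≤ c) (n : ℕ) :
    assocOff α c n * assocOff α c n = (c + (n + 1)) * (α + c + (n + 1)) := by
  have : (0 : ℝ) ≤ n := n.cast_nonneg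
  rw [assocOff, mul_mul_mul_comm, Real.mul_self_sqrt (by linarith), Real.mul_self_sqrt (by linarith)]

/-- The action of the Jacobi matrix on sequences. -/
def tridiagOp (d u : ℕ → ℝ) : Module.End ℝ (ℕ → ℝ) where
  toFun v n := u n * v (n + 1) + d n * v n + Nat.casesOn n 0 fun m => u m * v m
  map_add' v w := by
    ext n
    rcases n with _ | n <;> simp <;> ring
  map_smul' a v := by
    ext n
    rcases n with _ | n <;> simp <;> ring

theorem tridiagOp_apply_zero (d u v : ℕ → ℝ) :
    tridiagOp d u v 0 = u 0 * v 1 + d 0 * v 0 := by simp [tridiagOp]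

theorem tridiagOp_apply_succ (d u v : ℕ → ℝ) (n : ℕ) :
    tridiagOp d u v (n + 1) = u (n + 1) * v (n + 2) + d (n + 1) * v (n + 1) + u n * v n := by
  simp [tridiagOp]

theorem assocLaguerreW_apply_eq_zero {α c : ℝ} {i k : ℕ} (h : i ≠ k) (h' : i ≠ k + 1) :
    assocLaguerreW α c i k = 0 := by
  simp [assocLaguerreW, h, h']

theorem assocLaguerreJ_apply (α c : ℝ) (i j : ℕ) : assocLaguerreJ α c i j =
    ∑ k ∈ range (i + 1), assocLaguerreW α c i k * assocLaguerreW α c j k := by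
  rw [assocLaguerreJ, infMul, Matrix.of_apply]
  refine finsum_eq_finsetSum_of_support_subset _ fun k hk => ?_
  by_contra hk'
  simp only [coe_range, Set.mem_Iio, not_lt] at hk'
  exact hk (mul_eq_zero_of_left (assocLaguerreW_apply_eq_zero (by omega) (by omega)) _)

theorem assocLaguerreJ_symm (α c : ℝ) (i j : ℕ) :
    assocLaguerreJ α c i j = assocLaguerreJ α c j i := by
  simp only [assocLaguerreJ, infMul, Matrix.of_apply, Matrix.transpose_apply, mul_comm]

theorem assocLaguerreJ_diag {α c : ℝ} (hα : -1 < α) (hc : 0 ≤ c) (i : ℕ) :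
    assocLaguerreJ α c i i = assocDiag α c i := by
  have hi : (0 : ℝ) ≤ i := i.cast_nonneg
  rw [assocLaguerreJ_apply]
  rcases i with _ | i
  · simp [assocLaguerreW, assocDiag]
    rw [Real.mul_self_sqrt (by linarith)]
  · push_cast at hi
    rw [sum_range_succ, sum_range_succ, sum_eq_zero]
    · simp [assocLaguerreW, assocDiag]
      rw [Real.mul_self_sqrt (by linarith), Real.mul_self_sqrt (by linarith)]
      ring
    · intro k hk
      have := mem_range.1 hk
      rw [assocLaguerreW_apply_eq_zero (by omega) (by omega), zero_mul]

theorem assocLaguerreJ_succ (α c : ℝ) (i : ℕ) :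
    assocLaguerreJ α c i (i + 1) = assocOff α c i := by
  rw [assocLaguerreJ_apply, sum_range_succ, sum_eq_zero]
  · simp [assocLaguerreW, assocOff, mul_comm]
  · intro k hk
    have := mem_range.1 hk
    rw [assocLaguerreW_apply_eq_zero (i := i + 1) (by omega) (by omega), mul_zero]

theorem assocLaguerreJ_of_lt (α c : ℝ) {i j : ℕ} (h : i + 1 < j) :
    assocLaguerreJ α c i j = 0 := by
  rw [assocLaguerreJ_apply, sum_eq_zero]
  intro k hk
  have := mem_range.1 hk
  rw [assocLaguerreW_apply_eq_zero (i := j) (by omega) (by omega), mul_zero]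

/-- The operator given by `assocLaguerreJ α c`. -/
abbrev assocOp (α c : ℝ) : Module.End ℝ (ℕ → ℝ) := tridiagOp (assocDiag α c) (assocOff α c)

theorem assocOp_apply_eq_sum {α c : ℝ} (hα : -1 < α) (hc : 0 ≤ c) (v : ℕ → ℝ) (i : ℕ) :
    assocOp α c v i = ∑ k ∈ range (i + 2), assocLaguerreJ α c i k * v k := by
  rcases i with _ | i
  · simp [sum_range_succ, tridiagOp_apply_zero, assocLaguerreJ_diag hα hc, assocLaguerreJ_succ]
    ring
  · rw [sum_range_succ, sum_range_succ, sum_range_succ, sum_eq_zero, assocLaguerreJ_diag hα hc,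
      assocLaguerreJ_succ, assocLaguerreJ_symm, assocLaguerreJ_succ, tridiagOp_apply_succ]
    · ring
    · intro k hk
      have := mem_range.1 hk
      rw [assocLaguerreJ_symm, assocLaguerreJ_of_lt α c (by omega), zero_mul]

theorem assocOp_single {α c : ℝ} (hα : -1 < α) (hc : 0 ≤ c) (j : ℕ) :
    assocOp α c (Pi.single j 1) =
      ∑ k ∈ range (j + 2), assocLaguerreJ α c k j • (Pi.single k 1 : ℕ → ℝ) := by
  ext i
  rw [assocOp_apply_eq_sum hα hc]
  simp only [Finset.sum_apply, Pi.smul_apply, Pi.single_apply, smul_eq_mul, mul_ite, mul_one,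
    mul_zero, Finset.sum_ite_eq, Finset.sum_ite_eq', mem_range]
  split_ifs with h1 h2 h2
  · rfl
  · exact assocLaguerreJ_symm α c i j ▸ assocLaguerreJ_of_lt α c (by omega)
  · exact (assocLaguerreJ_of_lt α c (by omega)).symm
  · rfl

/-- Transfers the powers to the ring `Module.End`, where commutators can be manipulated freely. -/
theorem infPow_assocLaguerreJ {α c : ℝ} (hα : -1 < α) (hc : 0 ≤ c) (r i j : ℕ) :
    infPow (assocLaguerreJ α c) r i j = (assocOp α c ^ r) (Pi.single j 1) i := by
  induction r generalizing j with
  | zero => simp [infPow, Matrix.one_apply, Pi.single_apply]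
  | succ r ih =>
    rw [infPow, infMul, Matrix.of_apply, pow_succ, Module.End.mul_apply, assocOp_single hα hc,
      map_sum, Finset.sum_apply]
    rw [finsum_eq_finsetSum_of_support_subset (s := range (j + 2))]
    · refine sum_congr rfl fun k _ => ?_
      rw [ih, map_smul, Pi.smul_apply, smul_eq_mul, mul_comm]
    · intro k hk
      by_contra hk'
      simp only [coe_range, Set.mem_Iio, not_lt] at hk'
      exact hk (mul_eq_zero_of_right _
        (assocLaguerreJ_symm α c k j ▸ assocLaguerreJ_of_lt α c (by omega)))

theorem commutator_pow_succ {R : Type*} [Ring R] (T J : R) (r : ℕ) :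
    T * J ^ (r + 1) - J ^ (r + 1) * T =
      ∑ p ∈ antidiagonal r, J ^ p.1 * (T * J - J * T) * J ^ p.2 := by
  induction r with
  | zero => simp
  | succ r ih =>
    have h : T * J ^ (r + 2) - J ^ (r + 2) * T =
        (T * J - J * T) * J ^ (r + 1) + J * (T * J ^ (r + 1) - J ^ (r + 1) * T) := by
      rw [pow_succ' J (r + 1)]
      noncomm_ring
    rw [h, ih, Finset.Nat.antidiagonal_succ, Finset.sum_cons, Finset.sum_map, Finset.mul_sum]
    simp [pow_succ', mul_assoc]

theorem pow_mul_double_commutator_mul_pow {R : Type*} [Ring R] [Algebra ℝ R] (J P : R) (c : ℝ)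
    (a b : ℕ) : J ^ a * -((2 : ℝ) • J + c • (J * P + P * J)) * J ^ b =
      -((2 : ℝ) • J ^ (a + b + 1) + c • (J ^ (a + 1) * P * J ^ b + J ^ a * P * J ^ (b + 1))) := by
  rw [add_right_comm, pow_add J (a + 1), pow_succ J a, pow_succ' J b]
  simp only [mul_neg, neg_mul, mul_add, add_mul, mul_smul_comm, smul_mul_assoc, mul_assoc]

/-- Multiplication of the `n`-th coordinate by `n`. -/
def numberOp : Module.End ℝ (ℕ → ℝ) where
  toFun v n := n * v n
  map_add' v w := by ext n; simp [mul_add]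
  map_smul' a v := by ext n; simp [mul_left_comm]

/-- The projection onto the first coordinate. -/
def vacuumOp : Module.End ℝ (ℕ → ℝ) where
  toFun v := v 0 • Pi.single 0 1
  map_add' v w := by simp [add_smul]
  map_smul' a v := by simp [mul_smul]

theorem numberOp_apply (v : ℕ → ℝ) (n : ℕ) : numberOp v n = n * v n := rfl

theorem vacuumOp_apply (v : ℕ → ℝ) : vacuumOp v = v 0 • Pi.single 0 1 := rfl

/-- Away from the corner this holds because the squared off-diagonal entries are quadratic in `n`,
with differences matching the linear diagonal. For `c = 0` the relation is exactly `[[N, J], J] = -2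
J`; the shift `c` breaks it only at the first coordinate, which produces the projection terms. -/
theorem assocOp_double_commutator {α c : ℝ} (hα : -1 < α) (hc : 0 ≤ c) :
    (numberOp * assocOp α c - assocOp α c * numberOp) * assocOp α c -
      assocOp α c * (numberOp * assocOp α c - assocOp α c * numberOp) =
      -((2 : ℝ) • assocOp α c + c • (assocOp α c * vacuumOp + vacuumOp * assocOp α c)) := by
  have hu := assocOff_sq hα hc
  have hd : ∀ n, assocDiag α c (n + 1) = (α + c + (n + 2)) + (c + (n + 1)) := fun n => rfl
  have hd0 : assocDiag α c 0 = α + c + 1 := rfl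
  refine LinearMap.ext fun v => funext fun n => ?_
  rcases n with _ | _ | n
  · have h0 := hu 0
    simp [tridiagOp_apply_zero, tridiagOp_apply_succ, numberOp_apply, vacuumOp_apply, hd, hd0]
    push_cast at h0
    linear_combination (-2 * v 0) * h0
  · have h0 := hu 0
    have h1 := hu 1
    simp [tridiagOp_apply_zero, tridiagOp_apply_succ, numberOp_apply, vacuumOp_apply, hd, hd0]
    push_cast at h0 h1
    linear_combination (-2 * v 1) * h1 + (2 * v 1) * h0
  · have h0 := hu (n + 1)
    have h1 := hu (n + 2)
    simp [tridiagOp_apply_zero, tridiagOp_apply_succ, numberOp_apply, vacuumOp_apply, hd, hd0]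
    push_cast at h0 h1
    linear_combination (-2 * v (n + 2)) * h1 + (2 * v (n + 2)) * h0

/-- The upper left entry of an operator. -/
def vacuumExp : Module.End ℝ (ℕ → ℝ) →ₗ[ℝ] ℝ where
  toFun A := A (Pi.single 0 1) 0
  map_add' _ _ := rfl
  map_smul' _ _ := rfl

theorem vacuumExp_apply (A : Module.End ℝ (ℕ → ℝ)) : vacuumExp A = A (Pi.single 0 1) 0 := rfl

theorem vacuumExp_mul_vacuumOp_mul (A B : Module.End ℝ (ℕ → ℝ)) :
    vacuumExp (A * vacuumOp * B) = vacuumExp A * vacuumExp B := by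
  simp [vacuumExp_apply, vacuumOp_apply, mul_comm]

/-- The moments of `assocLaguerreJ α c`. -/
def assocMoment (α c : ℝ) (r : ℕ) : ℝ := infPow (assocLaguerreJ α c) r 0 0

theorem assocMoment_eq {α c : ℝ} (hα : -1 < α) (hc : 0 ≤ c) (r : ℕ) :
    assocMoment α c r = vacuumExp (assocOp α c ^ r) :=
  infPow_assocLaguerreJ hα hc r 0 0

/-- The vacuum expectation of `[T, J ^ (r + 1)]`, with `T = [N, J]`, is computed in two ways:
directly, as `T` acts simply at the vacuum on either side, and by expanding into double commutators,
whose projections split the expectation into products of moments. -/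
theorem momentRec_assocMoment {α c : ℝ} (hα : -1 < α) (hc : 0 ≤ c) :
    MomentRec α c (assocMoment α c) := by
  refine ⟨by simp [assocMoment, infPow], fun r => ?_⟩
  set J := assocOp α c with hJ
  set m := fun r => vacuumExp (J ^ r) with hm
  have hmm : assocMoment α c = m := funext fun r => assocMoment_eq hα hc r
  have hd0 : assocDiag α c 0 = α + c + 1 := rfl
  rw [hmm]
  rcases r with _ | r
  · simp [hm, vacuumExp_apply, hJ, tridiagOp_apply_zero, hd0]
    ring
  set T := numberOp * J - J * numberOp with hT
  have hTw : ∀ w : ℕ → ℝ, T w 0 = -(J w 0) + (α + c + 1) * w 0 := by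
    intro w
    simp [hT, hJ, numberOp_apply, tridiagOp_apply_zero, hd0]
  have hTe : T (Pi.single 0 1) = J (Pi.single 0 1) - (α + c + 1) • (Pi.single 0 1 : ℕ → ℝ) := by
    ext n
    rcases n with _ | _ | n <;>
      simp [hT, hJ, numberOp_apply, tridiagOp_apply_zero, tridiagOp_apply_succ, hd0]
  have h1 : vacuumExp (T * J ^ (r + 1)) = -m (r + 2) + (α + c + 1) * m (r + 1) := by
    rw [vacuumExp_apply, Module.End.mul_apply, hTw, ← Module.End.mul_apply, ← pow_succ']
    rfl
  have h2 : vacuumExp (J ^ (r + 1) * T) = m (r + 2) - (α + c + 1) * m (r + 1) := by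
    rw [vacuumExp_apply, Module.End.mul_apply, hTe, map_sub, map_smul, ← Module.End.mul_apply,
      ← pow_succ]
    rfl
  have h3 := congrArg vacuumExp (commutator_pow_succ T J r)
  have h4 : ∀ p ∈ antidiagonal r, vacuumExp (J ^ p.1 * (T * J - J * T) * J ^ p.2) =
      -(2 * m (r + 1) + c * (m (p.1 + 1) * m p.2 + m p.1 * m (p.2 + 1))) := by
    intro p hp
    rw [assocOp_double_commutator hα hc, ← mem_antidiagonal.1 hp]
    rw [pow_mul_double_commutator_mul_pow]
    simp only [map_neg, map_add, map_smul, vacuumExp_mul_vacuumOp_mul, smul_eq_mul, hm]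
  rw [map_sub, map_sum, sum_congr rfl h4, h1, h2, sum_neg_distrib, sum_add_distrib, sum_const,
    Finset.Nat.card_antidiagonal, ← mul_sum, sum_add_distrib, nsmul_eq_mul] at h3
  have h5 : ∑ p ∈ antidiagonal r, m (p.1 + 1) * m p.2 =
      ∑ p ∈ antidiagonal r, m p.1 * m (p.2 + 1) := by
    rw [← Finset.Nat.sum_antidiagonal_swap]
    exact sum_congr rfl fun p _ => mul_comm _ _
  have h6 : ∑ p ∈ antidiagonal r, m p.1 * m (p.2 + 1) =
      ∑ l ∈ range (r + 1), m l * m (r + 1 - l) := by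
    rw [Finset.Nat.sum_antidiagonal_eq_sum_range_succ_mk]
    refine sum_congr rfl fun l hl => ?_
    rw [Nat.succ_sub (Nat.le_of_lt_succ (mem_range.1 hl))]
  rw [h5, h6] at h3
  push_cast at h3 ⊢
  linear_combination (-1 / 2) * h3

end

end BetaLaguerre

/-! ### Existence and uniqueness of the spectral measure -/

namespace BetaLaguerre

open Finset

noncomputable section

/-- The measure puts at each eigenvalue the squared first component of its normalized eigenvector.
-/
theorem exists_measure_of_isHermitian {n : ℕ} {A : Matrix (Fin (n + 1)) (Fin (n + 1)) ℝ}
    (hA : A.IsHermitian) : ∃ μ : ProbabilityMeasure ℝ, ∀ k : ℕ,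
      Integrable (fun x : ℝ => x ^ k) (μ : Measure ℝ) ∧
        ∫ x, x ^ k ∂(μ : Measure ℝ) = (A ^ k) 0 0 := by
  set U : Matrix (Fin (n + 1)) (Fin (n + 1)) ℝ := hA.eigenvectorUnitary.1 with hU
  have hpow : ∀ k : ℕ, (A ^ k) 0 0 = ∑ i, U 0 i ^ 2 * hA.eigenvalues i ^ k := by
    intro k
    conv_lhs => rw [hA.spectral_theorem, ← map_pow, Matrix.diagonal_pow,
      Unitary.conjStarAlgAut_apply]
    rw [Matrix.mul_apply]
    refine sum_congr rfl fun i _ => ?_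
    rw [Matrix.mul_diagonal]
    rw [Matrix.star_apply, star_trivial, ← hU]
    change U 0 i * hA.eigenvalues i ^ k * U 0 i = _
    ring
  set μ : Measure ℝ := ∑ i, ENNReal.ofReal (U 0 i ^ 2) • Measure.dirac (hA.eigenvalues i) with hμ
  have hprob : IsProbabilityMeasure μ := by
    constructor
    have h0 := hpow 0
    simp only [pow_zero, Matrix.one_apply_eq, mul_one] at h0
    simp only [hμ, Measure.finsetSum_apply, Measure.smul_apply, measure_univ, smul_eq_mul, mul_one]
    rw [← ENNReal.ofReal_sum_of_nonneg fun i _ => sq_nonneg _, ← h0, ENNReal.ofReal_one]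
  refine ⟨⟨μ, hprob⟩, fun k => ?_⟩
  have hint : ∀ i ∈ (univ : Finset (Fin (n + 1))), Integrable (fun x : ℝ => x ^ k)
      (ENNReal.ofReal (U 0 i ^ 2) • Measure.dirac (hA.eigenvalues i)) := fun i _ =>
    (integrable_dirac (by simp)).smul_measure ENNReal.ofReal_ne_top
  refine ⟨integrable_finsetSum_measure.2 hint, ?_⟩
  change ∫ x, x ^ k ∂μ = _
  rw [hμ, integral_finsetSum_measure hint, hpow]
  refine sum_congr rfl fun i _ => ?_
  rw [integral_smul_measure, integral_dirac, ENNReal.toReal_ofReal (sq_nonneg _), smul_eq_mul]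

theorem assocOp_pow_apply_of_lt {α c : ℝ} (k : ℕ) {i : ℕ} (h : k < i) :
    (assocOp α c ^ k) (Pi.single 0 1) i = 0 := by
  induction k generalizing i with
  | zero => simp [h.ne']
  | succ k ih =>
    obtain ⟨i, rfl⟩ : ∃ j, i = j + 1 := ⟨i - 1, by omega⟩
    rw [pow_succ', Module.End.mul_apply, tridiagOp_apply_succ, ih (by omega), ih (by omega),
      ih (by omega)]
    simp

/-- After `k` applications of a tridiagonal matrix the first basis vector is supported in `[0, k]`,
so the truncation is not felt as long as `k ≤ n`. -/
theorem truncated_pow_mulVec {α c : ℝ} (hα : -1 < α) (hc : 0 ≤ c) (n k : ℕ) (hk : k ≤ n)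
    (i : Fin (n + 1)) :
    (((Matrix.of fun i j : Fin (n + 1) => assocLaguerreJ α c i j) ^ k).mulVec (Pi.single 0 1)) i =
      (assocOp α c ^ k) (Pi.single 0 1) i := by
  induction k generalizing i with
  | zero =>
    rw [pow_zero, pow_zero, Matrix.one_mulVec, Module.End.one_apply]
    rcases eq_or_ne i 0 with rfl | hi
    · simp
    · rw [Pi.single_eq_of_ne hi, Pi.single_eq_of_ne (Fin.val_ne_zero_iff.2 hi)]
  | succ k ih =>
    rw [pow_succ', ← Matrix.mulVec_mulVec, pow_succ', Module.End.mul_apply,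
      assocOp_apply_eq_sum hα hc, Matrix.mulVec, dotProduct]
    simp only [Matrix.of_apply, ih (by omega)]
    rw [Fin.sum_univ_eq_sum_range
      (fun j => assocLaguerreJ α c i j * (assocOp α c ^ k) (Pi.single 0 1) j) (n + 1)]
    have h1 : ∑ j ∈ range (n + 1), assocLaguerreJ α c i j * (assocOp α c ^ k) (Pi.single 0 1) j =
        ∑ j ∈ range (n + 2), assocLaguerreJ α c i j * (assocOp α c ^ k) (Pi.single 0 1) j := by
      rw [sum_range_succ _ (n + 1), assocOp_pow_apply_of_lt k (by omega), mul_zero, add_zero]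
    rw [h1]
    symm
    refine sum_subset (range_subset_range.2 (by omega)) fun j _ hj => ?_
    rw [mem_range, not_lt] at hj
    rw [assocLaguerreJ_of_lt α c (by omega), zero_mul]

theorem exists_measure_truncated {α c : ℝ} (hα : -1 < α) (hc : 0 ≤ c) (n : ℕ) :
    ∃ μ : ProbabilityMeasure ℝ, ∀ k ≤ n, Integrable (fun x : ℝ => x ^ k) (μ : Measure ℝ) ∧
      ∫ x, x ^ k ∂(μ : Measure ℝ) = assocMoment α c k := by
  have hA : (Matrix.of fun i j : Fin (n + 1) => assocLaguerreJ α c i j).IsHermitian := by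
    ext i j
    simp [assocLaguerreJ_symm α c i j]
  obtain ⟨μ, hμ⟩ := exists_measure_of_isHermitian hA
  refine ⟨μ, fun k hk => ⟨(hμ k).1, ?_⟩⟩
  rw [(hμ k).2, assocMoment, infPow_assocLaguerreJ hα hc]
  have := truncated_pow_mulVec hα hc n k hk 0
  rw [Matrix.mulVec_single_one] at this
  exact this

/-- The truncation of `t` to `[-R, R]`. -/
def clamp (R t : ℝ) : ℝ := max (-R) (min t R)

theorem abs_clamp_le {R : ℝ} (hR : 0 ≤ R) (t : ℝ) : |clamp R t| ≤ R :=
  abs_le.2 ⟨le_max_left _ _, max_le (by linarith) (min_le_right _ _)⟩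

theorem abs_sub_clamp_le {R : ℝ} (hR : 0 < R) (t : ℝ) : |t - clamp R t| ≤ t ^ 2 / R := by
  rw [le_div_iff₀ hR]
  unfold clamp
  rcases le_total t R with h | h
  · rw [min_eq_left h]
    rcases le_total (-R) t with h' | h'
    · rw [max_eq_right h']; simp; positivity
    · rw [max_eq_left h', abs_of_nonpos (by linarith)]; nlinarith
  · rw [min_eq_right h, max_eq_right (by linarith), abs_of_nonneg (by linarith)]; nlinarith

/-- Method of moments, for weak limits along a filter. -/
theorem moments_of_tendsto {l : Filter ℕ} [l.NeBot] {ν : ℕ → ProbabilityMeasure ℝ}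
    {μ : ProbabilityMeasure ℝ} (hν : Tendsto ν l (𝓝 μ)) {m : ℕ → ℝ}
    (h : ∀ k, ∀ᶠ n in l, Integrable (fun x : ℝ => x ^ k) (ν n : Measure ℝ) ∧
      ∫ x, x ^ k ∂(ν n : Measure ℝ) = m k) (k : ℕ) :
    Integrable (fun x : ℝ => x ^ k) (μ : Measure ℝ) ∧ ∫ x, x ^ k ∂(μ : Measure ℝ) = m k := by
  rw [ProbabilityMeasure.tendsto_iff_forall_integral_tendsto] at hν
  -- Even powers first: bounded truncations pass to the weak limit, and monotone convergence removes
  -- the truncation.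
  have heven : ∀ k, Integrable (fun x : ℝ => (x ^ k) ^ 2) (μ : Measure ℝ) ∧
      ∫ x, (x ^ k) ^ 2 ∂(μ : Measure ℝ) ≤ m (k * 2) := by
    intro k
    have hb : ∀ R : ℕ, ∫⁻ x, ENNReal.ofReal (min ((x ^ k) ^ 2) R) ∂(μ : Measure ℝ) ≤
        ENNReal.ofReal (m (k * 2)) := by
      intro R
      let g : BoundedContinuousFunction ℝ ℝ := BoundedContinuousFunction.ofNormedAddCommGroup
        (fun x => min ((x ^ k) ^ 2) (R : ℝ)) (by fun_prop) R fun x => by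
          rw [Real.norm_of_nonneg (le_min (sq_nonneg _) (Nat.cast_nonneg _))]
          exact min_le_right _ _
      change ∫⁻ x, ENNReal.ofReal (g x) ∂(μ : Measure ℝ) ≤ _
      rw [← ofReal_integral_eq_lintegral_ofReal (g.integrable _)
        (Eventually.of_forall fun x => le_min (sq_nonneg _) (Nat.cast_nonneg _))]
      refine ENNReal.ofReal_le_ofReal (le_of_tendsto (hν g) ?_)
      filter_upwards [h (k * 2)] with n hn
      rw [← hn.2]
      refine integral_mono (g.integrable _) hn.1 fun x => ?_
      simp only [pow_mul]
      exact min_le_left _ _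
    have hl : ∫⁻ x, ENNReal.ofReal ((x ^ k) ^ 2) ∂(μ : Measure ℝ) ≤
        ENNReal.ofReal (m (k * 2)) := by
      have : ∀ x : ℝ, ENNReal.ofReal ((x ^ k) ^ 2) =
          ⨆ R : ℕ, ENNReal.ofReal (min ((x ^ k) ^ 2) R) := by
        intro x
        refine le_antisymm ?_ (iSup_le fun R => ENNReal.ofReal_le_ofReal (min_le_left _ _))
        obtain ⟨R, hR⟩ := exists_nat_ge ((x ^ k) ^ 2)
        refine le_iSup_of_le R ?_
        rw [min_eq_left hR]
      simp only [this]
      rw [lintegral_iSup]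
      · exact iSup_le hb
      · intro R; fun_prop
      · intro R R' hR x
        exact ENNReal.ofReal_le_ofReal (min_le_min_left _ (by exact_mod_cast hR))
    have hint : Integrable (fun x : ℝ => (x ^ k) ^ 2) (μ : Measure ℝ) := by
      refine ⟨by fun_prop, ?_⟩
      rw [hasFiniteIntegral_iff_ofReal (Eventually.of_forall fun x => sq_nonneg _)]
      exact hl.trans_lt ENNReal.ofReal_lt_top
    refine ⟨hint, ?_⟩
    rw [← ofReal_integral_eq_lintegral_ofReal hint (Eventually.of_forall fun x => sq_nonneg _)]
      at hl
    have hm : 0 ≤ m (k * 2) := by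
      obtain ⟨n, hn⟩ := (h (k * 2)).exists
      rw [← hn.2]
      exact integral_nonneg fun x => by simp only [pow_mul]; exact sq_nonneg _
    exact (ENNReal.ofReal_le_ofReal_iff hm).1 hl
  have hint : Integrable (fun x : ℝ => x ^ k) (μ : Measure ℝ) := by
    refine ((heven k).1.add (integrable_const (1 : ℝ))).mono' (by fun_prop)
      (Eventually.of_forall fun x => ?_)
    rw [Real.norm_eq_abs, Pi.add_apply, ← sq_abs (x ^ k)]
    nlinarith [sq_nonneg (|x ^ k| - 1)]
  refine ⟨hint, ?_⟩
  -- The clamping error is controlled by the moment of order `2 * k`, uniformly over the sequence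
  -- and its limit.
  have hbd : ∀ (ρ : ProbabilityMeasure ℝ) (R : ℝ), 0 < R →
      Integrable (fun x : ℝ => x ^ k) (ρ : Measure ℝ) →
      Integrable (fun x : ℝ => (x ^ k) ^ 2) (ρ : Measure ℝ) →
      ∫ x, (x ^ k) ^ 2 ∂(ρ : Measure ℝ) ≤ m (k * 2) →
      |∫ x, x ^ k ∂(ρ : Measure ℝ) - ∫ x, clamp R (x ^ k) ∂(ρ : Measure ℝ)| ≤
        m (k * 2) / R := by
    intro ρ R hR h1 h2 h3
    have hc : Integrable (fun x : ℝ => clamp R (x ^ k)) (ρ : Measure ℝ) := by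
      refine (integrable_const R).mono' (by unfold clamp; fun_prop) (Eventually.of_forall fun x => ?_)
      exact abs_clamp_le hR.le _
    rw [← integral_sub h1 hc]
    refine (abs_integral_le_integral_abs).trans ?_
    refine le_trans (integral_mono (h1.sub hc).abs (h2.div_const R) fun x =>
      abs_sub_clamp_le hR (x ^ k)) ?_
    rw [integral_div]
    exact div_le_div_of_nonneg_right h3 hR.le
  have hmain : ∀ R : ℝ, 0 < R → |∫ x, x ^ k ∂(μ : Measure ℝ) - m k| ≤ 2 * m (k * 2) / R := by
    intro R hR
    let g : BoundedContinuousFunction ℝ ℝ := BoundedContinuousFunction.ofNormedAddCommGroup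
      (fun x => clamp R (x ^ k)) (by unfold clamp; fun_prop) R fun x => abs_clamp_le hR.le _
    have h1 := hbd μ R hR hint (heven k).1 (heven k).2
    have h2 : |m k - ∫ x, clamp R (x ^ k) ∂(μ : Measure ℝ)| ≤ m (k * 2) / R := by
      refine le_of_tendsto ((tendsto_const_nhds.sub (hν g)).abs) ?_
      filter_upwards [h k, h (k * 2)] with n hn hn'
      rw [← hn.2]
      simp only [pow_mul] at hn'
      exact hbd (ν n) R hR hn.1 hn'.1 hn'.2.le
    rw [abs_le] at *
    rw [mul_div_assoc]
    constructor <;> linarith [h1.1, h1.2, h2.1, h2.2]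
  by_contra hne
  have hpos : 0 < |∫ x, x ^ k ∂(μ : Measure ℝ) - m k| := abs_pos.2 (sub_ne_zero.2 hne)
  have hlim : Tendsto (fun R : ℝ => 2 * m (k * 2) / R) atTop (𝓝 0) :=
    tendsto_const_nhds.div_atTop tendsto_id
  obtain ⟨R, hR1, hR2⟩ := ((hlim.eventually_lt_const hpos).and (eventually_gt_atTop 0)).exists
  exact absurd (hmain R hR2) (not_le.2 hR1)

theorem isTightMeasureSet_of_second_moment {S : Set (Measure ℝ)} {M : ℝ}
    (h : ∀ μ ∈ S, Integrable (fun x : ℝ => x ^ 2) μ ∧ ∫ x, x ^ 2 ∂μ ≤ M) :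
    IsTightMeasureSet S := by
  rw [isTightMeasureSet_iff_exists_isCompact_measure_compl_le]
  intro ε hε
  have hlim : Tendsto (fun R : ℕ => ENNReal.ofReal M / (R : ENNReal)) atTop (𝓝 0) :=
    ENNReal.Tendsto.const_div ENNReal.tendsto_nat_nhds_top (Or.inr ENNReal.ofReal_ne_top)
      |>.trans (by simp)
  obtain ⟨R, hR1, hR2⟩ := ((hlim.eventually_lt_const hε).and (eventually_ge_atTop 1)).exists
  refine ⟨Metric.closedBall 0 R, isCompact_closedBall 0 _, fun μ hμ => ?_⟩
  have hsub : (Metric.closedBall (0 : ℝ) R)ᶜ ⊆ {x | (R : ENNReal) ≤ ENNReal.ofReal (x ^ 2)} := by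
    intro x hx
    simp only [Set.mem_compl_iff, Metric.mem_closedBall, dist_zero_right, Real.norm_eq_abs,
      not_le] at hx
    have hR : (1 : ℝ) ≤ R := by exact_mod_cast hR2
    rw [Set.mem_ofPred_eq, ← ENNReal.ofReal_natCast]
    refine ENNReal.ofReal_le_ofReal ?_
    rw [← sq_abs]
    nlinarith
  refine (measure_mono hsub).trans ((meas_ge_le_lintegral_div (by fun_prop) (by
    have : R ≠ 0 := by omega
    exact_mod_cast this) (ENNReal.natCast_ne_top R)).trans (le_trans ?_ hR1.le))
  gcongr
  rw [← ofReal_integral_eq_lintegral_ofReal (h μ hμ).1 (Eventually.of_forall fun x => sq_nonneg _)]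
  exact ENNReal.ofReal_le_ofReal (h μ hμ).2

theorem exists_solvesMomentProblem {α c : ℝ} (hα : -1 < α) (hc : 0 ≤ c) :
    ∃ μ : Measure ℝ, SolvesMomentProblem (assocLaguerreJ α c) μ := by
  -- The shift by `2` gives every member the correct second moment, as tightness requires.
  choose ν hν using fun n => exists_measure_truncated hα hc (n + 2)
  have htight : IsTightMeasureSet
      {((μ : ProbabilityMeasure ℝ) : Measure ℝ) | μ ∈ Set.range ν} := by
    refine isTightMeasureSet_of_second_moment (M := assocMoment α c 2) ?_
    rintro _ ⟨_, ⟨n, rfl⟩, rfl⟩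
    exact ⟨(hν n 2 (by omega)).1, (hν n 2 (by omega)).2.le⟩
  have hcomp := isCompact_closure_of_isTightMeasureSet htight
  -- By Prokhorov's theorem a limit along a nonprincipal ultrafilter exists, so no subsequence is
  -- needed; each moment is eventually constant along it.
  obtain ⟨μ, -, hμ⟩ := hcomp.ultrafilter_le_nhds ((hyperfilter ℕ).map ν) (by
    rw [le_principal_iff]
    exact mem_of_superset (Ultrafilter.mem_coe.2 (Ultrafilter.mem_map.2
      (mem_of_superset Filter.univ_mem fun n _ => Set.mem_range_self n))) subset_closure)
  have hmom := moments_of_tendsto (l := (hyperfilter ℕ : Filter ℕ)) (ν := ν) (μ := μ)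
    (m := assocMoment α c) hμ fun k => Nat.hyperfilter_le_atTop (by
      filter_upwards [eventually_ge_atTop k] with n hn using hν n k (by omega))
  exact ⟨μ, inferInstance, fun k => (hmom k).1, fun k => (hmom k).2⟩

theorem MomentRec.abs_le {α c : ℝ} (hc : 0 ≤ c) {m : ℕ → ℝ} (hm : MomentRec α c m)
    (r : ℕ) : |m r| ≤ (|α| + 1 + c) ^ r * r.factorial := by
  induction r using Nat.strong_induction_on with
  | _ r ih =>
  rcases r with _ | r
  · simp [hm.zero]
  set K := |α| + 1 + c with hK
  have hKpos : 0 ≤ K := by positivity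
  have hr : (0 : ℝ) ≤ r := r.cast_nonneg
  have h1 : |α + 1 + r + c| ≤ |α| + 1 + r + c := by
    refine (_root_.abs_le.2 ⟨?_, ?_⟩) <;> linarith [neg_abs_le α, le_abs_self α]
  have h2 : |∑ l ∈ range r, m l * m (r - l)| ≤ r * (K ^ r * r.factorial) := by
    refine (abs_sum_le_sum_abs _ _).trans ?_
    refine (sum_le_card_nsmul _ _ (K ^ r * r.factorial) fun l hl => ?_).trans_eq
      (by rw [card_range, nsmul_eq_mul])
    have hl' := mem_range.1 hl
    rw [abs_mul]
    refine (mul_le_mul (ih l (by omega)) (ih (r - l) (by omega)) (abs_nonneg _)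
      (by positivity)).trans ?_
    rw [mul_mul_mul_comm, ← pow_add, Nat.add_sub_cancel' hl'.le]
    -- The convolution sum thus costs only a factor `r`, which the passage from `r!` to `(r + 1)!`
    -- absorbs.
    have : l.factorial * (r - l).factorial ≤ r.factorial :=
      Nat.le_of_dvd r.factorial_pos (Nat.factorial_mul_factorial_dvd_factorial hl'.le)
    gcongr
    exact_mod_cast this
  have h3 := ih r (by omega)
  have hX : 0 ≤ K ^ r * r.factorial := by positivity
  rw [hm.succ]
  calc |(α + 1 + r + c) * m r + c * ∑ l ∈ range r, m l * m (r - l)|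
      ≤ |α + 1 + r + c| * |m r| + c * |∑ l ∈ range r, m l * m (r - l)| := by
        refine (abs_add_le _ _).trans ?_
        rw [abs_mul, abs_mul, abs_of_nonneg hc]
    _ ≤ (|α| + 1 + r + c) * (K ^ r * r.factorial) + c * (r * (K ^ r * r.factorial)) := by
        gcongr
    _ ≤ (K * (r + 1)) * (K ^ r * r.factorial) := by
        rw [← mul_assoc c, ← add_mul]
        refine mul_le_mul_of_nonneg_right ?_ hX
        rw [hK]
        nlinarith [mul_nonneg (abs_nonneg α) hr]
    _ = K ^ (r + 1) * (r + 1).factorial := by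
        rw [Nat.factorial_succ]
        push_cast
        ring

/-- A measure whose moments grow at most like `K ^ k * k!` has exponential moments. -/
theorem mem_integrableExpSet_of_moments {μ : Measure ℝ} {K : ℝ} (hK : 0 ≤ K)
    (hint : ∀ k : ℕ, Integrable (fun x : ℝ => x ^ k) μ)
    (hle : ∀ k : ℕ, |∫ x, x ^ k ∂μ| ≤ K ^ k * k.factorial) {t : ℝ} (ht : |t| * K < 1) :
    t ∈ integrableExpSet id μ := by
  have hnn : ∀ (k : ℕ) (x : ℝ), 0 ≤ (t * x) ^ (2 * k) / (2 * k).factorial := fun k x =>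
    div_nonneg (by rw [pow_mul]; positivity) (by positivity)
  have hI : ∀ k : ℕ, Integrable (fun x : ℝ => (t * x) ^ (2 * k) / (2 * k).factorial) μ := by
    intro k
    simp only [mul_pow]
    exact ((hint (2 * k)).const_mul _).div_const _
  -- The series of `cosh` has only nonnegative terms, so it may be integrated termwise, and `exp ≤ 2
  -- * cosh`.
  have hcosh : ∀ x : ℝ, ENNReal.ofReal (Real.cosh (t * x)) =
      ∑' k : ℕ, ENNReal.ofReal ((t * x) ^ (2 * k) / (2 * k).factorial) := by
    intro x
    rw [← ENNReal.ofReal_tsum_of_nonneg (fun k => hnn k x) (Real.hasSum_cosh _).summable,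
      (Real.hasSum_cosh _).tsum_eq]
  have hfin : ∫⁻ x, ENNReal.ofReal (Real.cosh (t * x)) ∂μ < ⊤ := by
    simp only [hcosh]
    rw [lintegral_tsum fun k => by fun_prop]
    have hb : ∀ k : ℕ, ∫⁻ x, ENNReal.ofReal ((t * x) ^ (2 * k) / (2 * k).factorial) ∂μ ≤
        ENNReal.ofReal (((|t| * K) ^ 2) ^ k) := by
      intro k
      rw [← ofReal_integral_eq_lintegral_ofReal (hI k) (Eventually.of_forall (hnn k))]
      refine ENNReal.ofReal_le_ofReal ?_
      simp only [mul_pow t]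
      rw [integral_div, integral_const_mul, div_le_iff₀ (by positivity), ← pow_mul,
        mul_pow, mul_assoc]
      refine (le_abs_self _).trans ?_
      rw [abs_mul, abs_pow]
      exact mul_le_mul_of_nonneg_left (hle _) (by positivity)
    refine (ENNReal.tsum_le_tsum hb).trans_lt ?_
    have hs : Summable fun k : ℕ => ((|t| * K) ^ 2) ^ k :=
      summable_geometric_of_lt_one (by positivity) (pow_lt_one₀ (by positivity) ht two_ne_zero)
    rw [← ENNReal.ofReal_tsum_of_nonneg (fun k => by positivity) hs]
    exact ENNReal.ofReal_lt_top
  have hci : Integrable (fun x => Real.cosh (t * x)) μ := by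
    refine ⟨(Real.continuous_cosh.comp (continuous_const.mul continuous_id)).aestronglyMeasurable,
      ?_⟩
    rwa [hasFiniteIntegral_iff_ofReal (Eventually.of_forall fun x => (Real.cosh_pos _).le)]
  refine (hci.const_mul 2).mono' (by simp only [id]; fun_prop) (Eventually.of_forall fun x => ?_)
  rw [Real.norm_of_nonneg (Real.exp_pos _).le, Real.cosh_eq, id]
  linarith [Real.exp_pos (-(t * x))]

/-- A probability measure whose moments grow at most like `K ^ k * k!` is determined by them. -/
theorem eq_of_moments_eq {μ ν : Measure ℝ} [IsProbabilityMeasure μ] [IsProbabilityMeasure ν]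
    {K : ℝ} (hK : 0 ≤ K) {m : ℕ → ℝ} (hm : ∀ k : ℕ, |m k| ≤ K ^ k * k.factorial)
    (hμ : ∀ k : ℕ, Integrable (fun x : ℝ => x ^ k) μ) (hμm : ∀ k : ℕ, ∫ x, x ^ k ∂μ = m k)
    (hν : ∀ k : ℕ, Integrable (fun x : ℝ => x ^ k) ν) (hνm : ∀ k : ℕ, ∫ x, x ^ k ∂ν = m k) :
    μ = ν := by
  -- `K + 1` rather than `K`, so that `K = 0` is covered and `δ * K < 1` is strict.
  set δ : ℝ := 1 / (K + 1) with hδ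
  have hδpos : 0 < δ := by positivity
  have hIoo : ∀ {ρ : Measure ℝ}, (∀ k : ℕ, Integrable (fun x : ℝ => x ^ k) ρ) →
      (∀ k : ℕ, ∫ x, x ^ k ∂ρ = m k) →
      Set.Ioo (-δ) δ ⊆ interior (integrableExpSet id ρ) := by
    intro ρ h1 h2
    refine interior_maximal (fun t ht => ?_) isOpen_Ioo
    refine mem_integrableExpSet_of_moments hK h1 (fun k => by rw [h2]; exact hm k) ?_
    have : |t| < δ := abs_lt.2 ht
    calc |t| * K ≤ δ * K := by gcongr
      _ < 1 := by rw [hδ, one_div, inv_mul_lt_iff₀ (by positivity)]; linarith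
  set S : Set ℂ := {z | z.re ∈ Set.Ioo (-δ) δ} with hS
  have hSpre : IsPreconnected S :=
    ((convex_Ioo (-δ) δ).linear_preimage Complex.reLm).isPreconnected
  have h0 : (0 : ℂ) ∈ S := by simp [hS, hδpos]
  have han : ∀ {ρ : Measure ℝ}, (∀ k : ℕ, Integrable (fun x : ℝ => x ^ k) ρ) →
      (∀ k : ℕ, ∫ x, x ^ k ∂ρ = m k) → AnalyticOnNhd ℂ (complexMGF id ρ) S :=
    fun h1 h2 => analyticOnNhd_complexMGF.mono fun z hz => hIoo h1 h2 hz
  have hder : ∀ {ρ : Measure ℝ}, (∀ k : ℕ, Integrable (fun x : ℝ => x ^ k) ρ) →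
      (∀ k : ℕ, ∫ x, x ^ k ∂ρ = m k) →
      ∀ k : ℕ, iteratedDeriv k (complexMGF id ρ) 0 = (m k : ℂ) := by
    intro ρ h1 h2 k
    rw [iteratedDeriv_complexMGF (hIoo h1 h2 h0), ← h2, ← integral_complex_ofReal]
    simp
  -- Equal moments are equal Taylor coefficients at `0`. The identity theorem extends the equality
  -- to the strip, which contains the imaginary axis, where the transform is the characteristic
  -- function.
  have heq : complexMGF id μ =ᶠ[𝓝 0] complexMGF id ν := by
    have e1 := (han hμ hμm 0 h0).hasFPowerSeriesAt
    have e2 := (han hν hνm 0 h0).hasFPowerSeriesAt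
    simp only [hder hμ hμm] at e1
    simp only [hder hν hνm] at e2
    filter_upwards [e1.eventually_hasSum_sub, e2.eventually_hasSum_sub] with z h1 h2
      using h1.unique h2
  have hEqOn := (han hμ hμm).eqOn_of_preconnected_of_eventuallyEq (han hν hνm) hSpre h0 heq
  refine Measure.ext_of_charFun (funext fun t => ?_)
  rw [← complexMGF_id_mul_I, ← complexMGF_id_mul_I]
  exact hEqOn (by simp [hS, hδpos])

theorem exists_isSpectralMeasure {α c : ℝ} (hα : -1 < α) (hc : 0 ≤ c) :
    ∃ μ : Measure ℝ, IsSpectralMeasure (assocLaguerreJ α c) μ := by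
  obtain ⟨μ, hμ⟩ := exists_solvesMomentProblem hα hc
  refine ⟨μ, hμ, fun ν hν => ?_⟩
  have := hμ.isProbabilityMeasure
  have := hν.isProbabilityMeasure
  exact eq_of_moments_eq (K := |α| + 1 + c) (by positivity)
    (fun k => (momentRec_assocMoment hα hc).abs_le hc k)
    hν.integrable_pow hν.moment_eq hμ.integrable_pow hμ.moment_eq

end

end BetaLaguerre

/-! ### Scaled chi variables and the expectation functional -/

namespace BetaLaguerre

open MvPolynomial Finset

noncomputable section

theorem integrable_and_integral_pow_scaledChi {k : ℝ} (hk : 0 < k) (e : ℕ) :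
    Integrable (fun x : ℝ => x ^ e) (scaledChiMeasure k) ∧
      ∫ x, x ^ e ∂(scaledChiMeasure k) = Real.Gamma ((k + e) / 2) / Real.Gamma (k / 2) := by
  have he : (0 : ℝ) ≤ e := e.cast_nonneg
  have hΓ : 0 < Real.Gamma (k / 2) := Real.Gamma_pos_of_pos (by positivity)
  set C : ℝ := 2 ^ (1 - k / 2) / Real.Gamma (k / 2) with hC
  have hm : Measurable fun x : ℝ => x / √2 := by fun_prop
  have hpow : ∀ x : ℝ, (x / √2) ^ e = x ^ e * (√2 ^ e)⁻¹ := fun x => by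
    rw [div_pow, div_eq_mul_inv]
  have hd : Measurable fun x : ℝ =>
      ENNReal.ofReal (C * x ^ (k - 1) * Real.exp (-x ^ 2 / 2)) := by fun_prop
  have hfin : ∀ᵐ x ∂(volume.restrict (Set.Ioi (0 : ℝ))),
      ENNReal.ofReal (C * x ^ (k - 1) * Real.exp (-x ^ 2 / 2)) < ⊤ :=
    Eventually.of_forall fun x => ENNReal.ofReal_lt_top
  have hcongr : Set.EqOn (fun x : ℝ => C * (x ^ (k + e - 1) * Real.exp (-(1 / 2) * x ^ (2 : ℝ))))
      (fun x => (ENNReal.ofReal (C * x ^ (k - 1) * Real.exp (-x ^ 2 / 2))).toReal • x ^ e)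
      (Set.Ioi 0) := by
    intro x hx
    have hx : 0 < x := hx
    dsimp only
    rw [ENNReal.toReal_ofReal (by positivity), Real.rpow_two, smul_eq_mul, add_sub_right_comm,
      Real.rpow_add hx, Real.rpow_natCast,
      show -x ^ 2 / 2 = -(1 / 2) * x ^ 2 by ring]
    ring
  have hint : Integrable (fun x : ℝ => x ^ e) (chiMeasure k) := by
    rw [chiMeasure, integrable_withDensity_iff_integrable_smul' hd hfin]
    refine IntegrableOn.congr_fun ?_ hcongr measurableSet_Ioi
    exact (integrableOn_rpow_mul_exp_neg_mul_rpow (by linarith) two_pos one_half_pos).const_mul C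
  constructor
  · rw [scaledChiMeasure, integrable_map_measure (by fun_prop) hm.aemeasurable]
    refine (hint.mul_const (√2 ^ e)⁻¹).congr (Eventually.of_forall fun x => ?_)
    exact (hpow x).symm
  · rw [scaledChiMeasure, integral_map hm.aemeasurable (by fun_prop)]
    simp only [hpow]
    rw [integral_mul_const, chiMeasure, integral_withDensity_eq_integral_toReal_smul hd hfin,
      ← setIntegral_congr_fun measurableSet_Ioi hcongr, integral_const_mul,
      integral_rpow_mul_exp_neg_mul_rpow two_pos (by linarith) one_half_pos, hC]
    have h2 : √2 ^ e = (2 : ℝ) ^ ((e : ℝ) / 2) := by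
      rw [Real.sqrt_eq_rpow, ← Real.rpow_natCast, ← Real.rpow_mul zero_le_two]
      congr 1
      ring
    have h3 : (1 / 2 : ℝ) ^ (-(k + e - 1 + 1) / 2) = 2 ^ (k / 2) * 2 ^ ((e : ℝ) / 2) := by
      rw [one_div, Real.inv_rpow zero_le_two, ← Real.rpow_neg zero_le_two,
        ← Real.rpow_add two_pos]
      congr 1
      ring
    have h4 : (2 : ℝ) ^ (1 - k / 2) = 2 / 2 ^ (k / 2) := by
      rw [Real.rpow_sub two_pos, Real.rpow_one]
    rw [h2, h3, h4, sub_add_cancel]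
    have : (0 : ℝ) < 2 ^ (k / 2) := by positivity
    have : (0 : ℝ) < 2 ^ ((e : ℝ) / 2) := by positivity
    field_simp

theorem isProbabilityMeasure_scaledChi {k : ℝ} (hk : 0 < k) :
    IsProbabilityMeasure (scaledChiMeasure k) := by
  have h := integrable_and_integral_pow_scaledChi hk 0
  have hΓ : 0 < Real.Gamma (k / 2) := Real.Gamma_pos_of_pos (by positivity)
  simp only [pow_zero, Nat.cast_zero, add_zero, div_self hΓ.ne', integral_const, smul_eq_mul,
    mul_one] at h
  exact isProbabilityMeasure_iff_real.2 h.2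

/-- The functional equation `Γ(s + 1) = s Γ(s)` is integration by parts on powers; by independence
and linearity it yields `IntByParts` for all polynomials. -/
theorem integral_pow_add_two_scaledChi {k : ℝ} (hk : 0 < k) (e : ℕ) :
    2 * ∫ x, x ^ (e + 2) ∂(scaledChiMeasure k) = (k + e) * ∫ x, x ^ e ∂(scaledChiMeasure k) := by
  have he : (0 : ℝ) ≤ e := e.cast_nonneg
  rw [(integrable_and_integral_pow_scaledChi hk _).2, (integrable_and_integral_pow_scaledChi hk _).2]
  have : (k + (e + 2 : ℕ)) / 2 = (k + e) / 2 + 1 := by push_cast; ring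
  rw [this, Real.Gamma_add_one (by positivity)]
  ring

section Pi

variable {ι : Type*} [Fintype ι] {μ : ι → Measure ℝ} [∀ i, IsProbabilityMeasure (μ i)]

theorem integrable_eval (hμ : ∀ i (e : ℕ), Integrable (fun x : ℝ => x ^ e) (μ i))
    (p : MvPolynomial ι ℝ) : Integrable (fun z => eval z p) (Measure.pi μ) := by
  simp only [eval_eq']
  refine integrable_finsetSum _ fun d _ => Integrable.const_mul ?_ _
  exact Integrable.fintype_prod fun i => hμ i (d i)

/-- The expectation of a polynomial in independent random variables. -/
def polyExpect (hμ : ∀ i (e : ℕ), Integrable (fun x : ℝ => x ^ e) (μ i)) :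
    MvPolynomial ι ℝ →ₗ[ℝ] ℝ where
  toFun p := ∫ z, eval z p ∂(Measure.pi μ)
  map_add' p q := by
    simp only [map_add]
    exact integral_add (integrable_eval hμ p) (integrable_eval hμ q)
  map_smul' a p := by
    simp only [smul_eval, integral_const_mul, RingHom.id_apply, smul_eq_mul]

theorem polyExpect_apply (hμ : ∀ i (e : ℕ), Integrable (fun x : ℝ => x ^ e) (μ i))
    (p : MvPolynomial ι ℝ) : polyExpect hμ p = ∫ z, eval z p ∂(Measure.pi μ) := rfl

theorem polyExpect_monomial (hμ : ∀ i (e : ℕ), Integrable (fun x : ℝ => x ^ e) (μ i))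
    (s : ι →₀ ℕ) (a : ℝ) :
    polyExpect hμ (monomial s a) = a * ∏ i, ∫ x, x ^ s i ∂(μ i) := by
  rw [polyExpect_apply, ← integral_fintype_prod_eq_prod, ← integral_const_mul]
  congr 1
  ext z
  rw [eval_monomial, Finsupp.prod_fintype _ _ (by simp)]

theorem polyExpect_one (hμ : ∀ i (e : ℕ), Integrable (fun x : ℝ => x ^ e) (μ i)) :
    polyExpect hμ 1 = 1 := by
  simp [polyExpect_apply]

end Pi

variable {n : ℕ}

theorem dof_pos {κ α : ℝ} (hκ : 0 < κ) (hα : -1 < α) (z : Idx n) : 0 < dof κ α z := by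
  rcases z with i | j
  · have : ((i : ℕ) : ℝ) ≤ n := by exact_mod_cast Nat.le_of_lt_succ i.2
    have := mul_nonneg hκ.le (sub_nonneg.2 this)
    simp only [dof, Sum.elim_inl]
    linarith
  · have : ((j : ℕ) : ℝ) < n := by exact_mod_cast j.2
    have := mul_pos hκ (sub_pos.2 this)
    simp only [dof, Sum.elim_inr]
    linarith

theorem logD_monomial (z : Idx n) (s : Idx n →₀ ℕ) (a : ℝ) :
    logD z (monomial s a) = (s z : ℝ) • monomial s a := by
  rw [logD, Derivation.smul_apply, smul_eq_mul, X_mul_pderiv_monomial, nsmul_eq_mul,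
    Algebra.smul_def, map_natCast]

theorem intByParts_polyExpect {κ α : ℝ} {μ : Idx n → Measure ℝ} [∀ i, IsProbabilityMeasure (μ i)]
    (hμ : ∀ i (e : ℕ), Integrable (fun x : ℝ => x ^ e) (μ i))
    (hrec : ∀ i (e : ℕ), 2 * ∫ x, x ^ (e + 2) ∂(μ i) = (dof κ α i + e) * ∫ x, x ^ e ∂(μ i)) :
    IntByParts κ α (polyExpect hμ) := by
  classical
  intro z h
  induction h using MvPolynomial.induction_on' with
  | monomial s a =>
    rw [logD_monomial, map_smul, smul_eq_mul, X_pow_eq_monomial, monomial_mul, one_mul,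
      polyExpect_monomial, polyExpect_monomial, ← mul_prod_erase _ _ (mem_univ z),
      ← mul_prod_erase univ (fun i => ∫ x, x ^ (Finsupp.single z 2 + s : Idx n →₀ ℕ) i ∂(μ i))
        (mem_univ z)]
    have h1 : ∏ i ∈ univ.erase z, ∫ x, x ^ (Finsupp.single z 2 + s : Idx n →₀ ℕ) i ∂(μ i) =
        ∏ i ∈ univ.erase z, ∫ x, x ^ s i ∂(μ i) := by
      refine prod_congr rfl fun i hi => ?_
      rw [Finsupp.add_apply, Finsupp.single_eq_of_ne (ne_of_mem_erase hi), zero_add]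
    rw [h1, Finsupp.add_apply, Finsupp.single_eq_same, add_comm 2]
    linear_combination (-(a * ∏ i ∈ univ.erase z, ∫ x, x ^ s i ∂(μ i))) * hrec z (s z)
  | add p q hp hq =>
    simp only [map_add, mul_add, hp, hq]
    ring

theorem map_eval_polyJ (z : Idx n → ℝ) : (polyJ n).map (eval z) =
    jacobi (N := n + 1) (fun i => z (Sum.inl i)) (fun j => z (Sum.inr j)) := by
  have h : (polyB n).map (eval z) =
      bidiagonal (N := n + 1) (fun i => z (Sum.inl i)) (fun j => z (Sum.inr j)) := by
    ext i j
    simp only [polyB, bidiagonal, Matrix.map_apply, Matrix.of_apply]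
    split_ifs <;> simp
  rw [polyJ, Matrix.map_mul, Matrix.transpose_map, h, jacobi]

theorem map_eval_polyJ_pow (z : Idx n → ℝ) (r : ℕ) : (polyJ n ^ r).map (eval z) =
    jacobi (N := n + 1) (fun i => z (Sum.inl i)) (fun j => z (Sum.inr j)) ^ r := by
  rw [← map_eval_polyJ]
  exact map_pow (eval z).mapMatrix (polyJ n) r

theorem eval_polyF (z : Idx n → ℝ) (r : ℕ) : eval z (polyF n r) =
    topLeft (jacobi (N := n + 1) (fun i => z (Sum.inl i)) (fun j => z (Sum.inr j)) ^ r) := by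
  rw [topLeft, dif_pos n.succ_pos, ← map_eval_polyJ_pow]
  rfl

theorem eval_polyTr (z : Idx n → ℝ) (r : ℕ) : eval z (polyTr n r) =
    (jacobi (N := n + 1) (fun i => z (Sum.inl i)) (fun j => z (Sum.inr j)) ^ r).trace := by
  rw [← map_eval_polyJ_pow, polyTr, Matrix.trace, Matrix.trace, map_sum]
  rfl

/-- The joint law of the entries of the bidiagonal matrix. -/
theorem map_eq_pi {Ω : Type*} [MeasurableSpace Ω] {P : Measure Ω} [IsProbabilityMeasure P]
    {κ α : ℝ} {x : Fin (n + 1) → Ω → ℝ} {y : Fin (n + 1 - 1) → Ω → ℝ}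
    (h : IsLaguerreModel P κ α x y) :
    AEMeasurable (fun ω (z : Idx n) => Sum.elim x y z ω) P ∧
      P.map (fun ω (z : Idx n) => Sum.elim x y z ω) =
        Measure.pi fun z : Idx n => scaledChiMeasure (dof κ α z) := by
  have hlaw : ∀ z : Idx n, HasLaw (Sum.elim x y z : Ω → ℝ) (scaledChiMeasure (dof κ α z)) P := by
    rintro (i | j)
    · have := h.law_diag i
      rw [Nat.cast_add, Nat.cast_one, add_sub_cancel_right] at this
      exact this
    · have := h.law_sub j
      rw [Nat.cast_add, Nat.cast_one, add_sub_cancel_right] at this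
      exact this
  refine ⟨aemeasurable_pi_lambda _ fun z => (hlaw z).aemeasurable, ?_⟩
  have := (iIndepFun_iff_map_fun_eq_pi_map fun z => (hlaw z).aemeasurable).1 h.indep
  simp only [(hlaw _).map_eq] at this
  exact this

end

end BetaLaguerre

/-! ### Assembly of the theorem -/

open BetaLaguerre in
theorem theorem3p4 (α c : ℝ) (hα : -1 < α) (hc : 0 ≤ c) :
    ∃ μ : Measure ℝ, BetaLaguerre.IsSpectralMeasure (BetaLaguerre.assocLaguerreJ α c) μ ∧
      ∀ (β : ℕ → ℝ), (∀ N, 1 ≤ N → 0 < β N) →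
        Tendsto (fun N : ℕ => β N * (N : ℝ)) atTop (𝓝 (2 * c)) →
      ∀ (Ω : ℕ → Type*) [∀ N, MeasurableSpace (Ω N)] (P : ∀ N, Measure (Ω N))
        [∀ N, IsProbabilityMeasure (P N)]
        (x : ∀ N, Fin N → Ω N → ℝ) (y : ∀ N, Fin (N - 1) → Ω N → ℝ),
        (∀ N, 1 ≤ N → BetaLaguerre.IsLaguerreModel (P N) (β N / 2) α (x N) (y N)) →
      ∀ r : ℕ,
        (∀ N : ℕ, 1 ≤ N →
          Integrable (fun ω => (1 / (N : ℝ)) *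
            ((BetaLaguerre.jacobi (fun i => x N i ω) (fun j => y N j ω)) ^ r).trace) (P N) ∧
          Integrable (fun ω => BetaLaguerre.topLeft
            ((BetaLaguerre.jacobi (fun i => x N i ω) (fun j => y N j ω)) ^ r)) (P N) ∧
          ∫ ω, (1 / (N : ℝ)) *
              ((BetaLaguerre.jacobi (fun i => x N i ω) (fun j => y N j ω)) ^ r).trace ∂(P N) =
            ∫ ω, BetaLaguerre.topLeft
              ((BetaLaguerre.jacobi (fun i => x N i ω) (fun j => y N j ω)) ^ r) ∂(P N)) ∧
        Tendsto (fun N : ℕ => ∫ ω, (1 / (N : ℝ)) *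
            ((BetaLaguerre.jacobi (fun i => x N i ω) (fun j => y N j ω)) ^ r).trace ∂(P N))
          atTop (𝓝 (∫ t, t ^ r ∂μ)) ∧
        Tendsto (fun N : ℕ => ∫ ω, BetaLaguerre.topLeft
            ((BetaLaguerre.jacobi (fun i => x N i ω) (fun j => y N j ω)) ^ r) ∂(P N))
          atTop (𝓝 (∫ t, t ^ r ∂μ)) := by
  obtain ⟨μ, hμ⟩ := exists_isSpectralMeasure hα hc
  refine ⟨μ, hμ, fun β hβ hβc Ω _ P _ x y hmodel r => ?_⟩
  -- From here on the matrix size is `N = n + 1`; size `0`, about which nothing is assumed, never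
  -- enters.
  have hκ : ∀ n : ℕ, 0 < β (n + 1) / 2 := fun n => half_pos (hβ _ (by omega))
  have hdof : ∀ n (z : Idx n), 0 < dof (β (n + 1) / 2) α z := fun n z => dof_pos (hκ n) hα z
  have hprob : ∀ n (z : Idx n),
      IsProbabilityMeasure (scaledChiMeasure (dof (β (n + 1) / 2) α z)) :=
    fun n z => isProbabilityMeasure_scaledChi (hdof n z)
  have hint : ∀ n (z : Idx n) (e : ℕ),
      Integrable (fun x : ℝ => x ^ e) (scaledChiMeasure (dof (β (n + 1) / 2) α z)) :=
    fun n z e => (integrable_and_integral_pow_scaledChi (hdof n z) e).1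
  set E : ∀ n, MvPolynomial (Idx n) ℝ →ₗ[ℝ] ℝ := fun n => polyExpect (hint n) with hE
  have hibp : ∀ n, IntByParts (β (n + 1) / 2) α (E n) := fun n =>
    intByParts_polyExpect (hint n) fun z e => integral_pow_add_two_scaledChi (hdof n z) e
  have htransfer : ∀ n (p : MvPolynomial (Idx n) ℝ),
      Integrable (fun ω => MvPolynomial.eval
        (fun z : Idx n => Sum.elim (x (n + 1)) (y (n + 1)) z ω) p) (P (n + 1)) ∧
      ∫ ω, MvPolynomial.eval (fun z : Idx n => Sum.elim (x (n + 1)) (y (n + 1)) z ω) p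
        ∂(P (n + 1)) = E n p := by
    intro n p
    obtain ⟨hm, hmap⟩ := map_eq_pi (hmodel (n + 1) (by omega))
    have hi := integrable_eval (hint n) p
    rw [← hmap] at hi
    refine ⟨(integrable_map_measure hi.1 hm).1 hi, ?_⟩
    rw [hE, polyExpect_apply, ← hmap, integral_map hm hi.1]
  have hF : ∀ n : ℕ, Integrable (fun ω => topLeft
        ((jacobi (fun i => x (n + 1) i ω) (fun j => y (n + 1) j ω)) ^ r)) (P (n + 1)) ∧
      ∫ ω, topLeft ((jacobi (fun i => x (n + 1) i ω) (fun j => y (n + 1) j ω)) ^ r)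
        ∂(P (n + 1)) = E n (polyF n r) := by
    intro n
    have := htransfer n (polyF n r)
    simp only [eval_polyF, Sum.elim_inl, Sum.elim_inr] at this
    exact this
  have hT : ∀ n : ℕ, Integrable (fun ω => (1 / ((n + 1 : ℕ) : ℝ)) *
        ((jacobi (fun i => x (n + 1) i ω) (fun j => y (n + 1) j ω)) ^ r).trace) (P (n + 1)) ∧
      ∫ ω, (1 / ((n + 1 : ℕ) : ℝ)) *
        ((jacobi (fun i => x (n + 1) i ω) (fun j => y (n + 1) j ω)) ^ r).trace
        ∂(P (n + 1)) = E n (polyF n r) := by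
    intro n
    have := htransfer n (polyTr n r)
    simp only [eval_polyTr, Sum.elim_inl, Sum.elim_inr] at this
    refine ⟨this.1.const_mul _, ?_⟩
    -- The empty product of traces gives the identity between normalized trace and corner entry.
    have h1 := expect_polyF_mul (hκ n).ne' (hibp n) r 0
    rw [polyProd_cons, polyProd_zero, mul_one, mul_one] at h1
    rw [integral_const_mul, this.2, ← h1, Nat.cast_add, Nat.cast_one, one_div,
      inv_mul_cancel_left₀ (by positivity)]
  have hlim : Tendsto (fun n => E n (polyF n r)) atTop (𝓝 (∫ t, t ^ r ∂μ)) := by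
    have hc' : Tendsto (fun n : ℕ => ((n : ℝ) + 1) * (β (n + 1) / 2)) atTop (𝓝 c) := by
      have := ((tendsto_add_atTop_iff_nat 1).2 hβc).div_const 2
      rw [mul_div_cancel_left₀ _ two_ne_zero] at this
      refine this.congr fun n => ?_
      push_cast
      ring
    have := tendsto_expect (momentRec_assocMoment hα hc) hibp (fun n => polyExpect_one (hint n))
      (fun n => (hκ n).ne') hc' r 0
    simp only [polyProd_zero, mul_one, Multiset.card_zero, pow_zero, div_one, Multiset.map_zero,
      Multiset.prod_zero] at this
    rw [hμ.solves.moment_eq r]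
    exact this
  refine ⟨?_, ?_, ?_⟩
  · rintro (_ | n) hN
    · omega
    · exact ⟨(hT n).1, (hF n).1, (hT n).2.trans (hF n).2.symm⟩
  · rw [← tendsto_add_atTop_iff_nat 1]
    exact hlim.congr fun n => (hT n).2.symm
  · rw [← tendsto_add_atTop_iff_nat 1]
    exact hlim.congr fun n => (hF n).2.symm
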